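/- Let $n\ge 0$, let $U\subset\mathbb R^n$ be open, and let $g=(g_1,\dots,g_n):U\to\mathbb R^n\setminus\{0\}$ be locally Lipschitz and satisfy Jacobi's integrability condition: for all $i,j,k\in\{1,\dots,n\}$, $$g_i\left(\frac{\partial g_j}{\partial x_k}-\frac{\partial g_k}{\partial x_j}\right)+g_j\left(\frac{\partial g_k}{\partial x_i}-\frac{\partial g_i}{\partial x_k}\right)+g_k\left(\frac{\partial g_i}{\partial x_j}-\frac{\partial g_j}{\partial x_i}\right)=0\quad\text{almost everywhere on }U.$$ A function $u:V\to\mathbb R$ is called a *normal solution* of the total differential equation $\nabla u(x)=\lambda(x)g(x)$ if (1) $V$ is open and $V\subset U$; (2) $u$ is locally Lipschitz; (3) every level set of $u$ is an $(n-1)$-dimensional $C^1$ manifold (an embedded submanifold of $\mathbb R^n$); (4) $g$ is a normal vector field of every level set $X$ of $u$, that is, $g(x)\cdot v=0$ for all $x\in X$ and $v\in T_x(X)$; (5) $u$ has no local maximum point and no local minimum point; (6) if $u$ is differentiable at $x$, then $\nabla u(x)\ne 0$. A normal solution $u:V\to\mathbb R$ is called *regular* if $V$ is connected and, for every $x\in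 V$, the function $t\mapsto u(x+tg(x))$ is strictly increasing on a neighborhood of $0$. A function $u:V\to\mathbb R$ on a convex set $V$ is called *strictly quasi-convex* if $u((1-t)x+ty)<\max\{u(x),u(y)\}$ for all $x,y\in V$ with $x\ne y$ and all $t\in(0,1)$. Consider the following three conditions. (I) For every $x^*\in U$ there exists an open neighborhood $V\subset U$ of $x^*$ such that for all $x,y\in V$ with $x\ne y$, $$g(x)\cdot y\ge g(x)\cdot x\ \Longrightarrow\ g(y)\cdot x<g(y)\cdot y.$$ (II) For all $x\in U$ and $v\in\mathbb R^n$, if $g(x)\cdot v=0$ and $v\ne0$, then $$\limsup_{t\downarrow0}\frac1t\,v\cdot g(x+tv)>0.$$ (III) Every regular solution $u$ of $\nabla u(x)=\lambda(x)g(x)$ defined on a convex domain is strictly quasi-convex. Then (I) is equivalent to (III), and (II) implies both (I) and (III). -/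

import Mathlib

open Set Filter Topology MeasureTheory

noncomputable section

namespace TDE

/-- Euclidean space of dimension `n`. -/
abbrev Euc (n : ℕ) : Type := EuclideanSpace ℝ (Fin n)

/-- `f` is a `C¹` map on an arbitrary set `X ⊆ ℝᴺ`: near every point of `X` it agrees on `X` with
a `C¹` map defined on a ball of the ambient space. -/
def IsC1On {N M : ℕ} (X : Set (Euc N)) (f : Euc N → Euc M) : Prop :=
  ∀ x ∈ X, ∃ r > 0, ∃ F : Euc N → Euc M,
    ContDiffOn ℝ 1 F (Metric.ball x r) ∧ ∀ y ∈ X ∩ Metric.ball x r, F y = f y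

/-- `φ : W → Y` is a local parametrization of `X ⊆ ℝᴺ`: a `C¹` diffeomorphism from an open set
`W ⊆ ℝᵈ` onto a relatively open subset `Y` of `X`. -/
structure IsLocalParam {N d : ℕ} (X : Set (Euc N)) (W : Set (Euc d)) (Y : Set (Euc N))
    (φ : Euc d → Euc N) : Prop where
  isOpen_source : IsOpen W
  relOpen_target : ∃ O : Set (Euc N), IsOpen O ∧ Y = X ∩ O
  bijOn : BijOn φ W Y
  c1 : IsC1On W φ
  c1_inv : ∃ ψ : Euc N → Euc d, InvOn ψ φ W Y ∧ IsC1On Y ψ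

/-- `X ⊆ ℝᴺ` is a `d`-dimensional `C¹` manifold (regular submanifold of `ℝᴺ`). -/
def IsC1Manifold {N : ℕ} (d : ℕ) (X : Set (Euc N)) : Prop :=
  ∀ x ∈ X, ∃ (W : Set (Euc d)) (Y : Set (Euc N)) (φ : Euc d → Euc N),
    IsLocalParam X W Y φ ∧ x ∈ Y

/-- The tangent space `T_x(X)` of a `d`-dimensional `C¹` manifold `X ⊆ ℝᴺ`: the range of
`Dφ(w)`, where `φ` is a local parametrization with `φ(w) = x` (it does not depend on `φ`). -/
def tangentSpaceAt {N : ℕ} (d : ℕ) (X : Set (Euc N)) (x : Euc N) : Set (Euc N) :=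
  {v | ∃ (W : Set (Euc d)) (Y : Set (Euc N)) (φ : Euc d → Euc N) (w : Euc d),
    IsLocalParam X W Y φ ∧ w ∈ W ∧ φ w = x ∧ v ∈ range (fderiv ℝ φ w)}

/-- `g` is a normal vector field of the `d`-dimensional `C¹` manifold `X`. -/
def IsNormalField {N : ℕ} (d : ℕ) (X : Set (Euc N)) (g : Euc N → Euc N) : Prop :=
  ∀ x ∈ X, ∀ v ∈ tangentSpaceAt d X x, inner ℝ (g x) v = 0

/-- The partial derivative `∂g_i/∂x_j` at `x` (meaningful where `g` is differentiable). -/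
def partialDeriv {n : ℕ} (g : Euc n → Euc n) (i j : Fin n) (x : Euc n) : ℝ :=
  fderiv ℝ g x (EuclideanSpace.single j 1) i

/-- Jacobi's integrability condition on `U`, almost everywhere. -/
def JacobiCondition {n : ℕ} (U : Set (Euc n)) (g : Euc n → Euc n) : Prop :=
  ∀ i j k : Fin n, ∀ᵐ x ∂(volume.restrict U),
    g x i * (partialDeriv g j k x - partialDeriv g k j x)
      + g x j * (partialDeriv g k i x - partialDeriv g i k x)
      + g x k * (partialDeriv g i j x - partialDeriv g j i x) = 0

/-- `u : V → ℝ` is a normal solution to `∇u(x) = λ(x) g(x)`, where `g` is given on `U`.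
(If `n = 0` and `g` has no zero on `U`, then `U = ∅`, so the truncation of `n - 1` at `n = 0` is
irrelevant.) -/
structure IsNormalSolution {n : ℕ} (U : Set (Euc n)) (g : Euc n → Euc n) (V : Set (Euc n))
    (u : Euc n → ℝ) : Prop where
  isOpen : IsOpen V
  subset : V ⊆ U
  locallyLipschitz : LocallyLipschitzOn V u
  level_manifold : ∀ c : ℝ, IsC1Manifold (n - 1) {x ∈ V | u x = c}
  level_normal : ∀ c : ℝ, IsNormalField (n - 1) {x ∈ V | u x = c} g
  no_localMax : ∀ x ∈ V, ¬ IsLocalMax u x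
  no_localMin : ∀ x ∈ V, ¬ IsLocalMin u x
  gradient_ne_zero : ∀ x ∈ V, DifferentiableAt ℝ u x → gradient u x ≠ 0

/-- A normal solution `u : V → ℝ` is regular if `V` is connected and, for every `x ∈ V`, the
function `t ↦ u(x + t g(x))` is (strictly) increasing around `0`. -/
structure IsRegularSolution {n : ℕ} (U : Set (Euc n)) (g : Euc n → Euc n) (V : Set (Euc n))
    (u : Euc n → ℝ) : Prop where
  normal : IsNormalSolution U g V u
  connected : IsConnected V
  increasing : ∀ x ∈ V, ∃ ε > 0, (∀ t ∈ Ioo (-ε) ε, x + t • g x ∈ V) ∧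
    StrictMonoOn (fun t : ℝ => u (x + t • g x)) (Ioo (-ε) ε)

/-- Strict quasi-convexity of `u` on a (convex) set `V`. -/
def StrictQuasiConvexOn {n : ℕ} (V : Set (Euc n)) (u : Euc n → ℝ) : Prop :=
  ∀ x ∈ V, ∀ y ∈ V, x ≠ y → ∀ t ∈ Ioo (0 : ℝ) 1,
    u ((1 - t) • x + t • y) < max (u x) (u y)

/-- Condition (I): the strict local condition on `g`. -/
def StrictLocalCondition {n : ℕ} (U : Set (Euc n)) (g : Euc n → Euc n) : Prop :=
  ∀ x₀ ∈ U, ∃ V : Set (Euc n), IsOpen V ∧ V ⊆ U ∧ x₀ ∈ V ∧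
    ∀ x ∈ V, ∀ y ∈ V, x ≠ y →
      inner ℝ (g x) y ≥ inner ℝ (g x) x → inner ℝ (g y) x < inner ℝ (g y) y

/-- Condition (II): the strict limsup condition on `g`. The upper limit as `t ↓ 0` is taken in the
extended reals. -/
def StrictLimsupCondition {n : ℕ} (U : Set (Euc n)) (g : Euc n → Euc n) : Prop :=
  ∀ x ∈ U, ∀ v : Euc n, inner ℝ (g x) v = 0 → v ≠ 0 →
    0 < limsup (fun t : ℝ => (((1 / t) * inner ℝ v (g (x + t • v)) : ℝ) : EReal)) (𝓝[>] (0 : ℝ))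

/-- Condition (III): every regular solution defined on a convex domain is strictly quasi-convex. -/
def RegularSolutionsStrictlyQuasiConvex {n : ℕ} (U : Set (Euc n)) (g : Euc n → Euc n) : Prop :=
  ∀ (V : Set (Euc n)) (u : Euc n → ℝ), Convex ℝ V → IsRegularSolution U g V u →
    StrictQuasiConvexOn V u

end TDE

end

/-!
The strict local condition gives strict quasi-convexity of a regular solution `u` as follows. If
strict quasi-convexity fails, `u` has a maximum along a segment at an interior point `z`, and
there the direction `v` of the segment is orthogonal to `g z`. The condition makes `⟪g (z + s v),
v⟫` positive for small `s > 0`, so `u` increases strictly along the segment to the right of `z`,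
which is absurd. All that is used about `u` is that near each point a *leaf function*
(`IsLeafFunction`, `IsRegularSolution.exists_isLeafFunction`) describes its level set; this comes
from the inverse function theorem and yields that `u` increases in every direction making an acute
angle with `g`.

The strict limsup condition gives the same conclusion. In the plane spanned by `v` and `g z` the
level curve of `z` is a `C¹` graph, and the condition together with the Lipschitz continuity of
`g` says that one Dini derivative of its slope is negative everywhere. Hence the slope is strictly
monotone (`lt_of_frequently_lt`), the curve leaves its tangent line on one side, and `u` cannot
have a maximum along that line at `z`.

Conversely, a regular solution that is strictly quasi-convex forces the inequality of the strict
local condition (`inner_lt_of_strictQuasiConvexOn`), so that this condition follows from the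
strict quasi-convexity of all regular solutions once every point has a convex neighbourhood
carrying one. This is Frobenius' theorem for Lipschitz fields (`exists_isRegularSolution`).
Normalise `g` to a field `G` with `⟪G, e⟫ = 1`; Jacobi's condition says that the hyperplane field
`G^⊥` has vanishing curvature almost everywhere. The leaf through `p` consists of the end points
of the integral curves of `h - ⟪G, h⟫ e` that issue from `p`. To see that it is tangent to `G^⊥`,
mollify `G` at scale `ε`. The curvature of the mollified field is `O(ε)` uniformly, because it is
linear in the derivative with Lipschitz coefficients (`exists_isAlmostFlat`). For the mollified
field Grönwall's inequality bounds the deviation from tangency by the curvature and an error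
quadratic in the increment, with a constant depending on `ε`; subdividing the increment removes
that error before `ε` tends to zero (`IsAlmostFlat.abs_descent_sub_sub_le`,
`abs_descent_sub_sub_le_of_flat`).
-/

noncomputable section

namespace TDE

open scoped RealInnerProductSpace

/-! ### Elementary real analysis -/

/-- Grönwall's inequality on `[0, 1]`, in a form that does not distinguish the case `K = 0`. -/
theorem norm_le_of_norm_deriv_le {f f' : ℝ → ℝ} {K δ ε : ℝ} (hK : 0 ≤ K) (hδ : 0 ≤ δ)
    (hε : 0 ≤ ε) (hf : ∀ t ∈ Icc (0 : ℝ) 1, HasDerivAt f (f' t) t) (h0 : |f 0| ≤ δ)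
    (hb : ∀ t ∈ Icc (0 : ℝ) 1, |f' t| ≤ K * |f t| + ε) :
    ∀ t ∈ Icc (0 : ℝ) 1, |f t| ≤ (δ + ε) * Real.exp K := by
  intro t ht
  have h := norm_le_gronwallBound_of_norm_deriv_right_le (f := f) (f' := f') (δ := δ) (K := K)
    (ε := ε) (a := 0) (b := 1) (fun s hs => (hf s hs).continuousAt.continuousWithinAt)
    (fun s hs => (hf s (Ico_subset_Icc_self hs)).hasDerivWithinAt) h0
    (fun s hs => hb s (Ico_subset_Icc_self hs)) t ht
  refine h.trans ((gronwallBound_mono hδ hε hK (by linarith [ht.2] : t - 0 ≤ 1)).trans ?_)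
  unfold gronwallBound
  split_ifs with hK0
  · subst hK0; simp
  · have hKp : 0 < K := lt_of_le_of_ne hK (Ne.symm hK0)
    have h1 : Real.exp K - 1 ≤ K * Real.exp K := by
      have h2 := Real.add_one_le_exp (-K)
      have h3 : Real.exp (-K) * Real.exp K = 1 := by rw [← Real.exp_add]; simp
      nlinarith [Real.exp_pos K]
    have : ε / K * (Real.exp K - 1) ≤ ε / K * (K * Real.exp K) := by gcongr
    have h4 : ε / K * (K * Real.exp K) = ε * Real.exp K := by field_simp
    rw [mul_one]
    linarith

/-- The reversed Grönwall inequality: a solution of `|f'| ≤ K |f|` on `[0, 1]` cannot be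
much smaller at a later time than at time `0`. -/
theorem abs_zero_le_of_abs_deriv_le {f f' : ℝ → ℝ} {K : ℝ} (hK : 0 ≤ K)
    (hf : ∀ t ∈ Icc (0 : ℝ) 1, HasDerivAt f (f' t) t)
    (hb : ∀ t ∈ Icc (0 : ℝ) 1, |f' t| ≤ K * |f t|) {s : ℝ} (hs : s ∈ Icc (0 : ℝ) 1) :
    |f 0| ≤ |f s| * Real.exp K := by
  have hm : ∀ t ∈ Icc (0 : ℝ) 1, s - s * t ∈ Icc (0 : ℝ) 1 := by
    intro t ht
    constructor <;> nlinarith [ht.1, ht.2, hs.1, hs.2]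
  have := norm_le_of_norm_deriv_le (f := fun t => f (s - s * t))
    (f' := fun t => f' (s - s * t) * (-s)) (ε := 0) hK (abs_nonneg (f s)) le_rfl
    (fun t ht => by
      have h1 : HasDerivAt (fun t : ℝ => s - s * t) (-s) t := by
        simpa using ((hasDerivAt_id t).const_mul s).const_sub s
      exact (hf _ (hm t ht)).comp t h1) (by simp)
    (fun t ht => by
      rw [abs_mul, abs_neg, abs_of_nonneg hs.1, add_zero]
      have h1 := hb _ (hm t ht)
      have h2 : 0 ≤ |f' (s - s * t)| := abs_nonneg _
      nlinarith [hs.2]) 1 (by simp)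
  simpa using this

/-- The forward lower bound, with sign: if `|f'| ≤ K |f|` on `[0, 1]` and `f 0 > 0`, then
`f 1 ≥ exp (-K) f 0`. -/
theorem le_mul_exp_of_abs_deriv_le {f f' : ℝ → ℝ} {K : ℝ} (hK : 0 ≤ K)
    (hf : ∀ t ∈ Icc (0 : ℝ) 1, HasDerivAt f (f' t) t)
    (hb : ∀ t ∈ Icc (0 : ℝ) 1, |f' t| ≤ K * |f t|) (h0 : 0 < f 0) :
    f 0 ≤ f 1 * Real.exp K := by
  have h1 := abs_zero_le_of_abs_deriv_le hK hf hb (s := 1) (by simp)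
  rw [abs_of_pos h0] at h1
  by_cases h : 0 ≤ f 1
  · rwa [abs_of_nonneg h] at h1
  · exfalso
    push Not at h
    have hc : ContinuousOn f (Icc 0 1) := fun s hs => (hf s hs).continuousAt.continuousWithinAt
    obtain ⟨s, hs, hs0⟩ := intermediate_value_Icc' zero_le_one hc ⟨h.le, h0.le⟩
    have h2 := abs_zero_le_of_abs_deriv_le hK hf hb hs
    rw [hs0, abs_of_pos h0] at h2
    simp at h2
    linarith

/-- A continuous function that, from every point, takes larger values arbitrarily close to the
right satisfies `f a < f b`. -/
theorem lt_of_frequently_lt {f : ℝ → ℝ} {a b : ℝ} (hab : a < b) (hf : ContinuousOn f (Icc a b))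
    (h : ∀ t ∈ Ico a b, ∃ᶠ s in 𝓝[>] t, f t < f s) : f a < f b := by
  have key : ∀ c ∈ Icc a b, f c ≤ f b := by
    intro c hc
    by_contra hlt
    push Not at hlt
    obtain ⟨μ, hμ1, hμ2⟩ := exists_between hlt
    have hsub : Icc c b ⊆ Icc a b := Icc_subset_Icc_left hc.1
    -- the last point at which `f ≥ μ` has no larger values close to its right
    have hcl : IsCompact (Icc c b ∩ f ⁻¹' Ici μ) :=
      isCompact_Icc.of_isClosed_subset
        ((hf.mono hsub).preimage_isClosed_of_isClosed isClosed_Icc isClosed_Ici) inter_subset_left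
    obtain ⟨ξ, ⟨hξ, hξμ⟩, hmax⟩ := hcl.exists_isGreatest ⟨c, ⟨le_rfl, hc.2⟩, hμ2.le⟩
    have hξb : ξ < b := lt_of_le_of_ne hξ.2 (by rintro rfl; exact absurd hξμ (not_le.2 hμ1))
    have hfr := h ξ ⟨(hsub hξ).1, hξb⟩
    have hev : ∀ᶠ s in 𝓝[>] ξ, s ∈ Ioo ξ b := Ioo_mem_nhdsGT hξb
    obtain ⟨s, hs1, hs2⟩ := (hfr.and_eventually hev).exists
    exact absurd (hmax ⟨⟨hξ.1.trans hs2.1.le, hs2.2.le⟩, hξμ.trans hs1.le⟩) (not_le.2 hs2.1)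
  obtain ⟨s, hs1, hs2⟩ := ((h a ⟨le_rfl, hab⟩).and_eventually (Ioo_mem_nhdsGT hab)).exists
  exact hs1.trans_le (key s ⟨hs2.1.le, hs2.2.le⟩)

/-- A function on `[0, 1]` whose increments are at most linear up to a quadratic error obeys the
linear bound. -/
theorem abs_sub_le_of_quadratic {f : ℝ → ℝ} {c M : ℝ}
    (h : ∀ x ∈ Icc (0 : ℝ) 1, ∀ y ∈ Icc (0 : ℝ) 1,
      |f y - f x| ≤ c * |y - x| + M * |y - x| ^ 2) : |f 1 - f 0| ≤ c := by
  have key : ∀ N : ℕ, |f 1 - f 0| ≤ c + M * (1 / ((N : ℝ) + 1)) := by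
    intro N
    have hN : (0 : ℝ) < (N : ℝ) + 1 := by positivity
    have hpt : ∀ j : ℕ, j ≤ N + 1 → (j : ℝ) / ((N : ℝ) + 1) ∈ Icc (0 : ℝ) 1 := by
      intro j hj
      have : (j : ℝ) ≤ (N : ℝ) + 1 := by exact_mod_cast hj
      exact ⟨by positivity, by rw [div_le_one hN]; exact this⟩
    have htel := Finset.sum_range_sub (fun j : ℕ => f ((j : ℝ) / ((N : ℝ) + 1))) (N + 1)
    have h1 : |f 1 - f 0| ≤ ∑ j ∈ Finset.range (N + 1),
        |f (((j + 1 : ℕ) : ℝ) / ((N : ℝ) + 1)) - f ((j : ℝ) / ((N : ℝ) + 1))| := by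
      refine le_trans (le_of_eq ?_) (Finset.abs_sum_le_sum_abs _ _)
      rw [htel]
      congr 2
      · push_cast; rw [div_self hN.ne']
      · simp
    have h2 : ∀ j ∈ Finset.range (N + 1),
        |f (((j + 1 : ℕ) : ℝ) / ((N : ℝ) + 1)) - f ((j : ℝ) / ((N : ℝ) + 1))| ≤
          c * (1 / ((N : ℝ) + 1)) + M * (1 / ((N : ℝ) + 1)) ^ 2 := by
      intro j hj
      have hj' := Finset.mem_range.1 hj
      have h3 := h _ (hpt j (by omega)) _ (hpt (j + 1) (by omega))
      have h4 : ((j + 1 : ℕ) : ℝ) / ((N : ℝ) + 1) - (j : ℝ) / ((N : ℝ) + 1)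
          = 1 / ((N : ℝ) + 1) := by
        push_cast; field_simp; ring
      rwa [h4, abs_of_pos (show (0 : ℝ) < 1 / ((N : ℝ) + 1) by positivity)] at h3
    refine h1.trans ((Finset.sum_le_sum h2).trans (le_of_eq ?_))
    rw [Finset.sum_const, Finset.card_range, nsmul_eq_mul]
    push_cast
    field_simp
  have hl : Tendsto (fun N : ℕ => c + M * (1 / ((N : ℝ) + 1))) atTop (𝓝 (c + M * 0)) :=
    (tendsto_one_div_add_atTop_nhds_zero_nat.const_mul M).const_add c
  simpa using ge_of_tendsto' hl key

/-! ### Integral curves of the horizontal vector fields -/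

section Horizontal

variable {E : Type*} [NormedAddCommGroup E] [InnerProductSpace ℝ E]

/-- A globally Lipschitz, bounded field `G` normalised by `⟪G, e⟫ = 1` for a unit vector `e`. The
hyperplanes `G(x)^⊥` are then transversal to `e`, and the vector field
`h - ⟪G, h⟫ e` is the horizontal lift of the constant field `h`. -/
structure IsTransversal (G : E → E) (e : E) (K B : ℝ) : Prop where
  norm_e : ‖e‖ = 1
  lip : ∀ x y, ‖G x - G y‖ ≤ K * ‖x - y‖
  bdd : ∀ x, ‖G x‖ ≤ B
  inner_e : ∀ x, ⟪G x, e⟫ = 1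
  K_nonneg : 0 ≤ K

/-- `t ↦ p + t h - σ(t) e`, `0 ≤ t ≤ 1`, is the integral curve of `h - ⟪G, h⟫ e` starting
at `p`. -/
structure IsHorizontal (G : E → E) (e p h : E) (σ : ℝ → ℝ) : Prop where
  zero : σ 0 = 0
  deriv : ∀ t ∈ Icc (0 : ℝ) 1, HasDerivAt σ ⟪G (p + t • h - σ t • e), h⟫ t

variable {G G₁ G₂ : E → E} {e p p₁ p₂ h h₁ h₂ : E} {K B δ : ℝ} {σ σ₁ σ₂ : ℝ → ℝ}

theorem IsTransversal.continuous (hG : IsTransversal G e K B) : Continuous G :=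
  (LipschitzWith.of_dist_le_mul (K := ⟨K, hG.K_nonneg⟩) fun x y => by
    rw [dist_eq_norm, dist_eq_norm]; exact hG.lip x y).continuous

theorem IsTransversal.B_nonneg (hG : IsTransversal G e K B) : 0 ≤ B :=
  (norm_nonneg _).trans (hG.bdd 0)

theorem IsHorizontal.exists (hG : IsTransversal G e K B) (p h : E) :
    ∃ σ, IsHorizontal G e p h σ := by
  have hB := hG.B_nonneg
  have hK := hG.K_nonneg
  have hp : IsPicardLindelof (fun t s : ℝ => ⟪G (p + t • h - s • e), h⟫) (tmin := -1) (tmax := 2)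
      ⟨0, by norm_num, by norm_num⟩ 0 ⟨2 * (B * ‖h‖), by positivity⟩ 0 ⟨B * ‖h‖, by positivity⟩
      ⟨K * ‖h‖, by positivity⟩ := by
    refine ⟨fun t _ => ?_, fun s _ => ?_, fun t _ s _ => ?_, ?_⟩
    · refine (LipschitzWith.of_dist_le_mul fun s s' => ?_).lipschitzOnWith
      rw [Real.dist_eq, Real.dist_eq, ← inner_sub_left]
      refine (abs_real_inner_le_norm _ _).trans ?_
      have h1 := hG.lip (p + t • h - s • e) (p + t • h - s' • e)
      have h2 : ‖p + t • h - s • e - (p + t • h - s' • e)‖ = |s - s'| := by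
        rw [show p + t • h - s • e - (p + t • h - s' • e) = -((s - s') • e) by module, norm_neg,
          norm_smul, hG.norm_e, mul_one, Real.norm_eq_abs]
      rw [h2] at h1
      calc _ ≤ K * |s - s'| * ‖h‖ := by gcongr
        _ = K * ‖h‖ * |s - s'| := by ring
    · have := hG.continuous
      fun_prop
    · exact (abs_real_inner_le_norm _ _).trans (by
        change _ ≤ B * ‖h‖
        gcongr; exact hG.bdd _)
    · change B * ‖h‖ * max (2 - 0) (0 - -1) ≤ 2 * (B * ‖h‖) - 0
      norm_num
      linarith
  obtain ⟨σ, h0, hσ⟩ := hp.exists_eq_forall_mem_Icc_hasDerivWithinAt₀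
  exact ⟨σ, h0, fun t ht => (hσ t ⟨by linarith [ht.1], by linarith [ht.2]⟩).hasDerivAt
    (Icc_mem_nhds (by linarith [ht.1]) (by linarith [ht.2]))⟩

/-- Stability of horizontal curves with respect to the field, the starting point and the
direction. -/
theorem IsHorizontal.abs_sub_le (hG₂ : IsTransversal G₂ e K B)
    (hδ : ∀ x, ‖G₁ x - G₂ x‖ ≤ δ) (hh : ‖h₁‖ ≤ 1)
    (h1 : IsHorizontal G₁ e p₁ h₁ σ₁) (h2 : IsHorizontal G₂ e p₂ h₂ σ₂) :
    ∀ t ∈ Icc (0 : ℝ) 1,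
      |σ₁ t - σ₂ t| ≤ (δ + K * ‖p₁ - p₂‖ + (K + B) * ‖h₁ - h₂‖) * Real.exp K := by
  have hB := hG₂.B_nonneg
  have hK := hG₂.K_nonneg
  have hδ0 : 0 ≤ δ := (norm_nonneg _).trans (hδ 0)
  have := norm_le_of_norm_deriv_le (f := fun t => σ₁ t - σ₂ t) (δ := 0)
    (ε := δ + K * ‖p₁ - p₂‖ + (K + B) * ‖h₁ - h₂‖) hK le_rfl (by positivity)
    (fun t ht => (h1.deriv t ht).sub (h2.deriv t ht)) (by simp [h1.zero, h2.zero])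
    (fun t ht => by
      set y₁ := p₁ + t • h₁ - σ₁ t • e
      set y₂ := p₂ + t • h₂ - σ₂ t • e
      have e1 : ⟪G₁ y₁, h₁⟫ - ⟪G₂ y₂, h₂⟫
          = ⟪G₁ y₁ - G₂ y₁, h₁⟫ + ⟪G₂ y₁ - G₂ y₂, h₁⟫ + ⟪G₂ y₂, h₁ - h₂⟫ := by
        simp only [inner_sub_left, inner_sub_right]; ring
      have hy : ‖y₁ - y₂‖ ≤ ‖p₁ - p₂‖ + ‖h₁ - h₂‖ + |σ₁ t - σ₂ t| := by
        rw [show y₁ - y₂ = (p₁ - p₂) + t • (h₁ - h₂) - (σ₁ t - σ₂ t) • e by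
          simp only [y₁, y₂]; module]
        refine (norm_sub_le _ _).trans ?_
        rw [norm_smul, hG₂.norm_e, mul_one, Real.norm_eq_abs]
        gcongr
        refine (norm_add_le _ _).trans ?_
        gcongr
        rw [norm_smul, Real.norm_of_nonneg ht.1]
        exact mul_le_of_le_one_left (norm_nonneg _) ht.2
      have b1 : |⟪G₁ y₁ - G₂ y₁, h₁⟫| ≤ δ * 1 :=
        (abs_real_inner_le_norm _ _).trans (by gcongr; exact hδ _)
      have b2 : |⟪G₂ y₁ - G₂ y₂, h₁⟫| ≤
          K * (‖p₁ - p₂‖ + ‖h₁ - h₂‖ + |σ₁ t - σ₂ t|) * 1 :=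
        (abs_real_inner_le_norm _ _).trans (by
          gcongr
          exact (hG₂.lip _ _).trans (by gcongr))
      have b3 : |⟪G₂ y₂, h₁ - h₂⟫| ≤ B * ‖h₁ - h₂‖ :=
        (abs_real_inner_le_norm _ _).trans (by gcongr; exact hG₂.bdd _)
      rw [e1]
      refine (abs_add_three _ _ _).trans ?_
      linarith)
  simpa using this

theorem IsHorizontal.unique (hG : IsTransversal G e K B) (hh : ‖h‖ ≤ 1)
    (h1 : IsHorizontal G e p h σ₁) (h2 : IsHorizontal G e p h σ₂) :
    ∀ t ∈ Icc (0 : ℝ) 1, σ₁ t = σ₂ t := by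
  intro t ht
  have := IsHorizontal.abs_sub_le (δ := 0) hG (by simp) hh h1 h2 t ht
  simp at this
  linarith

theorem IsHorizontal.abs_le (hG : IsTransversal G e K B)
    (h1 : IsHorizontal G e p h σ) : ∀ t ∈ Icc (0 : ℝ) 1, |σ t| ≤ B * ‖h‖ := by
  have hB := hG.B_nonneg
  have := norm_le_of_norm_deriv_le (f := σ) (δ := 0) (K := 0)
    (ε := B * ‖h‖) le_rfl le_rfl (by positivity) h1.deriv (by simp [h1.zero])
    (fun t ht => by
      rw [zero_mul, zero_add]
      exact (abs_real_inner_le_norm _ _).trans (by gcongr; exact hG.bdd _))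
  simpa using this

/-- Adding a multiple of `e` to the direction does not change the integral curve. -/
theorem IsHorizontal.add_smul (hG : IsTransversal G e K B) (h1 : IsHorizontal G e p h σ) (τ : ℝ) :
    IsHorizontal G e p (h + τ • e) (fun t => σ t + t * τ) := by
  refine ⟨by simp [h1.zero], fun t ht => ?_⟩
  rw [show p + t • (h + τ • e) - (σ t + t * τ) • e = p + t • h - σ t • e by module,
    inner_add_right, inner_smul_right, hG.inner_e, mul_one]
  have := (h1.deriv t ht).add ((hasDerivAt_id t).mul_const τ)
  rw [one_mul] at this
  exact this

/-- The time reversal of a horizontal curve is horizontal. -/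
theorem IsHorizontal.reverse (h1 : IsHorizontal G e p h σ) :
    IsHorizontal G e (p + h - σ 1 • e) (-h) (fun t => σ (1 - t) - σ 1) := by
  refine ⟨by simp, fun t ht => ?_⟩
  rw [show p + h - σ 1 • e + t • -h - (σ (1 - t) - σ 1) • e
    = p + (1 - t) • h - σ (1 - t) • e by module, inner_neg_right]
  have h2 : HasDerivAt (fun t : ℝ => 1 - t) (-1) t := by
    simpa using (hasDerivAt_id t).const_sub 1
  have := ((h1.deriv (1 - t) ⟨by linarith [ht.2], by linarith [ht.1]⟩).comp t h2).sub_const (σ 1)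
  simpa using this

/-- Horizontal curves with the same direction that start above each other stay above each
other, with a quantitative gap. -/
theorem IsHorizontal.gap (hG : IsTransversal G e K B) (hh : ‖h‖ ≤ 1) {τ : ℝ} (hτ : 0 < τ)
    (h1 : IsHorizontal G e p h σ₁) (h2 : IsHorizontal G e (p + τ • e) h σ₂) :
    τ ≤ (τ + σ₁ 1 - σ₂ 1) * Real.exp K := by
  have hK := hG.K_nonneg
  have := le_mul_exp_of_abs_deriv_le (f := fun t => τ + σ₁ t - σ₂ t) hK
    (fun t ht => ((h1.deriv t ht).const_add τ).sub (h2.deriv t ht))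
    (fun t ht => by
      rw [← inner_sub_left]
      refine (abs_real_inner_le_norm _ _).trans ?_
      refine (mul_le_of_le_one_right (norm_nonneg _) hh).trans ?_
      refine (hG.lip _ _).trans (le_of_eq ?_)
      rw [show p + t • h - σ₁ t • e - (p + τ • e + t • h - σ₂ t • e)
        = -((τ + σ₁ t - σ₂ t) • e) by module, norm_neg, norm_smul, hG.norm_e, mul_one,
        Real.norm_eq_abs])
    (by simpa [h1.zero, h2.zero] using hτ)
  simpa [h1.zero, h2.zero] using this

open Classical in
/-- A horizontal curve, chosen to be `0` where there is none. -/
def horizontalCurve (G : E → E) (e p h : E) : ℝ → ℝ :=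
  if H : ∃ σ, IsHorizontal G e p h σ then H.choose else 0

/-- The descent along `e`, at time one, of the horizontal curve that starts at `p` in
direction `h`; the curve ends at `p + h - descent G e p h • e`. -/
def descent (G : E → E) (e p h : E) : ℝ := horizontalCurve G e p h 1

theorem isHorizontal_horizontalCurve (hG : IsTransversal G e K B) (p h : E) :
    IsHorizontal G e p h (horizontalCurve G e p h) := by
  have H := IsHorizontal.exists hG p h
  unfold horizontalCurve
  rw [dif_pos H]
  exact H.choose_spec

theorem IsHorizontal.eq_descent (hG : IsTransversal G e K B) (hh : ‖h‖ ≤ 1)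
    (h1 : IsHorizontal G e p h σ) : σ 1 = descent G e p h :=
  h1.unique hG hh (isHorizontal_horizontalCurve hG p h) 1 (by simp)

theorem abs_descent_le (hG : IsTransversal G e K B) : |descent G e p h| ≤ B * ‖h‖ :=
  (isHorizontal_horizontalCurve hG p h).abs_le hG 1 (by simp)

theorem abs_descent_sub_le (hG : IsTransversal G e K B) (hh : ‖h₁‖ ≤ 1) :
    |descent G e p₁ h₁ - descent G e p₂ h₂| ≤
      (K * ‖p₁ - p₂‖ + (K + B) * ‖h₁ - h₂‖) * Real.exp K := by
  have := IsHorizontal.abs_sub_le (δ := 0) hG (by simp) hh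
    (isHorizontal_horizontalCurve hG p₁ h₁) (isHorizontal_horizontalCurve hG p₂ h₂) 1 (by simp)
  simpa [descent] using this

theorem descent_add_smul (hG : IsTransversal G e K B) {τ : ℝ} (hh' : ‖h + τ • e‖ ≤ 1) :
    descent G e p (h + τ • e) = descent G e p h + τ := by
  have := ((isHorizontal_horizontalCurve hG p h).add_smul hG τ).eq_descent hG hh'
  simp at this
  exact this.symm

theorem descent_reverse (hG : IsTransversal G e K B) (hh : ‖h‖ ≤ 1) :
    descent G e (p + h - descent G e p h • e) (-h) = - descent G e p h := by
  have := (isHorizontal_horizontalCurve hG p h).reverse.eq_descent hG (by simpa using hh)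
  simp [(isHorizontal_horizontalCurve hG p h).zero] at this
  exact this.symm

end Horizontal

/-! ### Mollification of a Lipschitz field with vanishing curvature -/

section Mollify

variable {E : Type*} [NormedAddCommGroup E] [InnerProductSpace ℝ E]

/-- The curvature of the field of hyperplanes `G^⊥` relative to `e`, at a point where `G` takes the
value `c` and has derivative `D`. If `⟪G, e⟫ = 1` everywhere, then `⟪D v, e⟫ = 0`, and this is the
exterior derivative of the one-form `⟪G, ·⟫` on the horizontal lifts of `a` and `b`. -/
def curvature (e c : E) (D : E →L[ℝ] E) (a b : E) : ℝ :=
  ⟪D (a - ⟪c, a⟫ • e), b⟫ - ⟪D (b - ⟪c, b⟫ • e), a⟫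

/-- `A` is a transversal field with derivative `A'` whose first-order Taylor expansion has an error
bounded quadratically with constant `M`, and whose curvature is at most `κ` on `D`. -/
structure IsAlmostFlat (A : E → E) (A' : E → E →L[ℝ] E) (e : E) (K B M κ : ℝ) (D : Set E) :
    Prop where
  transversal : IsTransversal A e K B
  hasFDerivAt : ∀ x, HasFDerivAt A (A' x) x
  norm_deriv_le : ∀ x, ‖A' x‖ ≤ K
  taylor : ∀ x y, ‖A y - A x - A' x (y - x)‖ ≤ M * ‖y - x‖ ^ 2
  M_nonneg : 0 ≤ M
  κ_nonneg : 0 ≤ κ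
  curvature_le : ∀ x ∈ D, ∀ a b, |curvature e (A x) (A' x) a b| ≤ κ * ‖a‖ * ‖b‖

variable [FiniteDimensional ℝ E] [MeasurableSpace E] [BorelSpace E]

/-- An average of vectors obeys any bound that the vectors near the origin obey. -/
theorem norm_integral_smul_le {F : Type*} [NormedAddCommGroup F] [NormedSpace ℝ F] {ρ : E → ℝ}
    {ε c : ℝ} {v : E → F} (hρ0 : ∀ z, 0 ≤ ρ z) (hρi : Integrable ρ volume) (hρ1 : ∫ z, ρ z = 1)
    (hρz : ∀ z, ε ≤ ‖z‖ → ρ z = 0) (hv : ∀ᵐ z, ‖z‖ < ε → ‖v z‖ ≤ c) :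
    ‖∫ z, ρ z • v z‖ ≤ c := by
  have h1 : ‖∫ z, ρ z • v z‖ ≤ ∫ z, ρ z * c := by
    refine norm_integral_le_of_norm_le (hρi.mul_const c) ?_
    filter_upwards [hv] with z hz
    rw [norm_smul, Real.norm_of_nonneg (hρ0 z)]
    by_cases hze : ‖z‖ < ε
    · exact mul_le_mul_of_nonneg_left (hz hze) (hρ0 z)
    · rw [hρz z (not_lt.1 hze)]; simp
  rwa [integral_mul_const, hρ1, one_mul] at h1

/-- Convolving a bounded measurable function with a compactly supported Lipschitz weight yields a
Lipschitz function. -/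
theorem exists_lipschitz_convolution {F : Type*} [NormedAddCommGroup F] [NormedSpace ℝ F]
    {ρ : E → ℝ} {ε K : ℝ} {C : NNReal} {v : E → F} (hC : LipschitzWith C ρ)
    (hρs : HasCompactSupport ρ) (hρz : ∀ z, ε ≤ ‖z‖ → ρ z = 0)
    (hvm : AEStronglyMeasurable v volume) (hv : ∀ z, ‖v z‖ ≤ K) :
    ∃ M, 0 ≤ M ∧ ∀ x y,
      ‖(∫ z, ρ z • v (x - z)) - ∫ z, ρ z • v (y - z)‖ ≤ M * ‖x - y‖ := by
  have hK : 0 ≤ K := (norm_nonneg _).trans (hv 0)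
  let χ : E → ℝ := (Metric.ball (0 : E) ε).indicator fun _ => 1
  have hχi : Integrable χ volume :=
    (integrable_indicator_iff measurableSet_ball).2
      (integrableOn_const (measure_ball_lt_top (μ := volume)).ne)
  have hχ0 : ∀ z, 0 ≤ χ z := fun z => indicator_nonneg (fun _ _ => zero_le_one) z
  have hχρ : ∀ z, χ z = 0 → ρ z = 0 := by
    intro z hz
    refine hρz z ?_
    by_contra h
    have : z ∈ Metric.ball (0 : E) ε := by simpa using h
    simp [χ, indicator_of_mem this] at hz
  have hχ1 : ∀ z, χ z ≠ 0 → χ z = 1 := by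
    intro z hz
    have := mem_of_indicator_ne_zero hz
    simp [χ, indicator_of_mem this]
  have hchange : ∀ x, ∫ z, ρ z • v (x - z) = ∫ w, ρ (x - w) • v w := by
    intro x
    rw [← integral_sub_left_eq_self (fun w => ρ (x - w) • v w) volume x]
    simp
  have hint : ∀ x, Integrable (fun w => ρ (x - w) • v w) volume := by
    intro x
    have h1 : Integrable ρ volume := hC.continuous.integrable_of_hasCompactSupport hρs
    refine ((h1.comp_sub_left x).mul_const K).norm.mono'
      ((h1.comp_sub_left x).aestronglyMeasurable.smul hvm) (Eventually.of_forall fun w => ?_)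
    rw [norm_smul, norm_mul, Real.norm_of_nonneg hK]
    exact mul_le_mul_of_nonneg_left (hv w) (norm_nonneg _)
  refine ⟨C * K * (∫ z, χ z) * 2, ?_, fun x y => ?_⟩
  · have := integral_nonneg (μ := volume) (f := χ) hχ0
    positivity
  · rw [hchange, hchange, ← integral_sub (hint x) (hint y)]
    have hb : ∀ w, ‖ρ (x - w) • v w - ρ (y - w) • v w‖ ≤
        C * K * ‖x - y‖ * (χ (x - w) + χ (y - w)) := by
      intro w
      rw [← sub_smul, norm_smul]
      have h1 : ‖ρ (x - w) - ρ (y - w)‖ ≤ C * ‖x - y‖ := by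
        have := hC.dist_le_mul (x - w) (y - w)
        rwa [dist_eq_norm, dist_eq_norm, sub_sub_sub_cancel_right] at this
      by_cases h0 : χ (x - w) = 0 ∧ χ (y - w) = 0
      · rw [hχρ _ h0.1, hχρ _ h0.2, h0.1, h0.2]; simp
      · have h2 : 1 ≤ χ (x - w) + χ (y - w) := by
          rcases not_and_or.1 h0 with h | h
          · rw [hχ1 _ h]; linarith [hχ0 (y - w)]
          · rw [hχ1 _ h]; linarith [hχ0 (x - w)]
        calc _ ≤ C * ‖x - y‖ * K := by gcongr; exact hv w
          _ = C * K * ‖x - y‖ * 1 := by ring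
          _ ≤ _ := by gcongr
    have hi1 := hχi.comp_sub_left x
    have hi2 := hχi.comp_sub_left y
    refine (norm_integral_le_of_norm_le ((hi1.add hi2).const_mul _)
      (Eventually.of_forall hb)).trans (le_of_eq ?_)
    rw [integral_const_mul]
    simp only [Pi.add_apply]
    rw [integral_add hi1 hi2, integral_sub_left_eq_self, integral_sub_left_eq_self]
    ring

/-- Mollifying a flat transversal Lipschitz field changes its curvature only by `O(ε)`: the
curvature is linear in the derivative with coefficients depending on `G`, and `G` varies by at most
`K ε` on the support of the mollifier. -/
theorem exists_isAlmostFlat {G : E → E} {e x₀ : E} {K B R : ℝ} (hG : IsTransversal G e K B)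
    (hflat : ∀ᵐ x ∂(volume.restrict (Metric.ball x₀ R)),
      ∀ a b, curvature e (G x) (fderiv ℝ G x) a b = 0)
    {ε : ℝ} (hε : 0 < ε) (hεR : ε ≤ R / 2) :
    ∃ (A : E → E) (A' : E → E →L[ℝ] E) (M : ℝ),
      IsAlmostFlat A A' e K B M (4 * K ^ 2 * ε) (Metric.ball x₀ (R / 2)) ∧
      ∀ x, ‖A x - G x‖ ≤ K * ε := by
  have hK := hG.K_nonneg
  have hGc := hG.continuous
  have hGL : LipschitzWith ⟨K, hK⟩ G := LipschitzWith.of_dist_le_mul fun x y => by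
    rw [dist_eq_norm, dist_eq_norm]; exact hG.lip x y
  let φ : ContDiffBump (0 : E) := ⟨ε / 2, ε, by positivity, by linarith⟩
  let ρ : E → ℝ := φ.normed volume
  have hρ0 : ∀ x, 0 ≤ ρ x := fun x => φ.nonneg_normed x
  have hρc : Continuous ρ := φ.continuous_normed
  have hρs : HasCompactSupport ρ := φ.hasCompactSupport_normed
  have hρi : Integrable ρ volume := hρc.integrable_of_hasCompactSupport hρs
  have hρ1 : ∫ z, ρ z = 1 := φ.integral_normed
  have hρz : ∀ z, ε ≤ ‖z‖ → ρ z = 0 := by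
    intro z hz
    have h1 : z ∉ Function.support ρ := by
      rw [φ.support_normed_eq]
      simpa [φ] using hz
    simpa using h1
  obtain ⟨C, hC⟩ : ∃ C, LipschitzWith C ρ :=
    (φ.contDiff_normed (n := 1)).lipschitzWith_of_hasCompactSupport hρs one_ne_zero
  -- the derivative of the mollified field is the mollified derivative, by Rademacher's theorem
  let A : E → E := fun x => ∫ z, ρ z • G (x - z)
  let A' : E → E →L[ℝ] E := fun x => ∫ z, ρ z • fderiv ℝ G (x - z)
  have hintA : ∀ x, Integrable (fun z => ρ z • G (x - z)) volume := fun x =>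
    (by fun_prop : Continuous fun z => ρ z • G (x - z)).integrable_of_hasCompactSupport
      hρs.smul_right
  have hDn : ∀ x, ‖fderiv ℝ G x‖ ≤ K := fun x => norm_fderiv_le_of_lipschitz ℝ hGL
  have hmeas : ∀ x, AEStronglyMeasurable (fun z => fderiv ℝ G (x - z)) volume := fun x =>
    ((measurable_fderiv ℝ G).comp (measurable_const.sub measurable_id)).aestronglyMeasurable
  have hintA' : ∀ x, Integrable (fun z => ρ z • fderiv ℝ G (x - z)) volume := fun x => by
    refine (hρi.mul_const K).mono' (hρc.aestronglyMeasurable.smul (hmeas x)) ?_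
    refine Eventually.of_forall fun z => ?_
    rw [norm_smul, Real.norm_of_nonneg (hρ0 z)]
    exact mul_le_mul_of_nonneg_left (hDn _) (hρ0 z)
  have hconst : ∀ {F : Type _} [NormedAddCommGroup F] [NormedSpace ℝ F] [CompleteSpace F] (v : F),
      ∫ z, ρ z • v = v := by
    intro F _ _ _ v
    rw [integral_smul_const, hρ1, one_smul]
  have hAG : ∀ x, ‖A x - G x‖ ≤ K * ε := by
    intro x
    have h1 : A x - G x = ∫ z, ρ z • (G (x - z) - G x) := by
      simp only [smul_sub]
      rw [integral_sub (hintA x) (hρi.smul_const _), hconst]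
    rw [h1]
    refine norm_integral_smul_le hρ0 hρi hρ1 hρz
      (Eventually.of_forall fun z hz => (hG.lip _ _).trans ?_)
    have : ‖x - z - x‖ = ‖z‖ := by rw [show x - z - x = -z by abel, norm_neg]
    rw [this]
    gcongr
  have htr : IsTransversal A e K B := by
    refine ⟨hG.norm_e, fun x y => ?_, fun x => norm_integral_smul_le hρ0 hρi hρ1 hρz
      (Eventually.of_forall fun z _ => hG.bdd _),
      fun x => ?_, hK⟩
    · have h1 : A x - A y = ∫ z, ρ z • (G (x - z) - G (y - z)) := by
        simp only [smul_sub]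
        rw [integral_sub (hintA x) (hintA y)]
      rw [h1]
      refine norm_integral_smul_le hρ0 hρi hρ1 hρz
        (Eventually.of_forall fun z hz => (hG.lip _ _).trans ?_)
      rw [sub_sub_sub_cancel_right]
    · have h1 := integral_inner (𝕜 := ℝ) (hintA x) e
      rw [real_inner_comm]
      change ⟪e, ∫ z, ρ z • G (x - z)⟫ = 1
      rw [← h1]
      have h2 : ∀ y, ⟪e, G y⟫ = 1 := fun y => by rw [real_inner_comm, hG.inner_e]
      simp_rw [inner_smul_right, h2, mul_one]
      exact hρ1
  have hderiv : ∀ x, HasFDerivAt A (A' x) x := by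
    intro x
    have hae : ∀ᵐ z, DifferentiableAt ℝ G (x - z) :=
      (Measure.measurePreserving_sub_left volume x).quasiMeasurePreserving.ae
        hGL.ae_differentiableAt
    refine (hasFDerivAt_integral_of_dominated_loc_of_lip' (F := fun y z => ρ z • G (y - z))
      (bound := fun z => ρ z * K) (s := univ) univ_mem
      (fun y _ => (hintA y).aestronglyMeasurable) (hintA x)
      (hintA' x).aestronglyMeasurable ?_ (hρi.mul_const K) ?_).2
    · refine Eventually.of_forall fun z y _ => ?_
      rw [← smul_sub, norm_smul, Real.norm_of_nonneg (hρ0 z), mul_assoc]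
      refine mul_le_mul_of_nonneg_left ((hG.lip _ _).trans (le_of_eq ?_)) (hρ0 z)
      rw [sub_sub_sub_cancel_right]
    · filter_upwards [hae] with z hz
      have := (hz.hasFDerivAt.comp x ((hasFDerivAt_id x).sub_const z)).const_smul (ρ z)
      exact this
  have hA'n : ∀ x, ‖A' x‖ ≤ K := fun x =>
    norm_integral_smul_le hρ0 hρi hρ1 hρz (Eventually.of_forall fun z _ => hDn _)
  obtain ⟨M, hM0, hM⟩ := exists_lipschitz_convolution hC hρs hρz
    (measurable_fderiv ℝ G).aestronglyMeasurable hDn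
  refine ⟨A, A', M, ⟨htr, hderiv, hA'n, fun x y => ?_, hM0, by positivity, fun x hx a b => ?_⟩, hAG⟩
  · have hconv : Convex ℝ (Metric.closedBall x ‖y - x‖) := convex_closedBall _ _
    have := hconv.norm_image_sub_le_of_norm_hasFDerivWithin_le' (f := A) (f' := A') (φ := A' x)
      (C := M * ‖y - x‖) (x := x) (y := y)
      (fun z _ => (hderiv z).hasFDerivWithinAt)
      (fun z hz => (hM z x).trans (by
        gcongr
        simpa [dist_eq_norm] using hz)) (by simp) (by simp [dist_eq_norm])
    rwa [mul_assoc, ← sq] at this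
  · have happ : ∀ v w : E, ⟪A' x v, w⟫ = ∫ z, ρ z • ⟪fderiv ℝ G (x - z) v, w⟫ := by
      intro v w
      have h1 : A' x v = ∫ z, (ρ z • fderiv ℝ G (x - z)) v :=
        ContinuousLinearMap.integral_apply (hintA' x) v
      rw [h1, real_inner_comm, ← integral_inner ((hintA' x).apply_continuousLinearMap v) w]
      simp_rw [_root_.smul_apply, inner_smul_right, smul_eq_mul, real_inner_comm]
    have hint : ∀ v w : E, Integrable (fun z => ρ z • ⟪fderiv ℝ G (x - z) v, w⟫) volume := by
      intro v w
      have := ((hintA' x).apply_continuousLinearMap v).const_inner (𝕜 := ℝ) w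
      simpa [inner_smul_right, real_inner_comm] using this
    have hae : ∀ᵐ z, x - z ∈ Metric.ball x₀ R →
        ∀ a b, curvature e (G (x - z)) (fderiv ℝ G (x - z)) a b = 0 :=
      (Measure.measurePreserving_sub_left volume x).quasiMeasurePreserving.ae
        ((ae_restrict_iff' measurableSet_ball).1 hflat)
    unfold curvature
    rw [happ, happ, ← integral_sub (hint _ _) (hint _ _)]
    simp_rw [← smul_sub]
    rw [← Real.norm_eq_abs]
    refine norm_integral_smul_le hρ0 hρi hρ1 hρz ?_
    filter_upwards [hae] with z hz hzε
    have hmem : x - z ∈ Metric.ball x₀ R := by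
      rw [Metric.mem_ball, dist_eq_norm] at hx ⊢
      rw [show x - z - x₀ = (x - x₀) - z by abel]
      linarith [norm_sub_le (x - x₀) z]
    have h0 := hz hmem a b
    unfold curvature at h0
    set D := fderiv ℝ G (x - z)
    have hd : ‖G (x - z) - A x‖ ≤ 2 * K * ε := by
      have h1 := hG.lip (x - z) x
      rw [show x - z - x = -z by abel, norm_neg] at h1
      have h2 := hAG x
      have h3 := norm_sub_le_norm_sub_add_norm_sub (G (x - z)) (G x) (A x)
      rw [norm_sub_rev (G x)] at h3
      nlinarith
    have e1 : ⟪D (a - ⟪A x, a⟫ • e), b⟫ - ⟪D (b - ⟪A x, b⟫ • e), a⟫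
        = ⟪G (x - z) - A x, a⟫ * ⟪D e, b⟫ - ⟪G (x - z) - A x, b⟫ * ⟪D e, a⟫ := by
      simp only [map_sub, map_smul, inner_sub_left, inner_smul_left] at h0 ⊢
      simp at h0 ⊢
      linarith
    have hDe : ∀ c, |⟪D e, c⟫| ≤ K * ‖c‖ := fun c =>
      (abs_real_inner_le_norm _ _).trans (by
        gcongr
        exact (D.le_of_opNorm_le (hDn _) e).trans (by rw [hG.norm_e, mul_one]))
    have hGA : ∀ c, |⟪G (x - z) - A x, c⟫| ≤ 2 * K * ε * ‖c‖ := fun c =>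
      (abs_real_inner_le_norm _ _).trans (by gcongr)
    rw [e1, Real.norm_eq_abs]
    refine (abs_sub _ _).trans ?_
    rw [abs_mul, abs_mul]
    have := mul_le_mul (hGA a) (hDe b) (abs_nonneg _) (by positivity)
    have := mul_le_mul (hGA b) (hDe a) (abs_nonneg _) (by positivity)
    nlinarith

end Mollify

/-! ### Integrability of flat Lipschitz fields -/

section Frobenius

variable {E : Type*} [NormedAddCommGroup E] [InnerProductSpace ℝ E]

/-- The end point of the horizontal curve that starts at `p` in direction `h`. -/
def leafPoint (G : E → E) (e p h : E) : E := p + h - descent G e p h • e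

variable {G A : E → E} {A' : E → E →L[ℝ] E} {e p q k x₀ : E} {K B M κ R r : ℝ}

theorem norm_leafPoint_sub_le (hG : IsTransversal G e K B) {h₁ h₂ : E} (hh : ‖h₁‖ ≤ 1) :
    ‖leafPoint G e p h₁ - leafPoint G e p h₂‖ ≤
      (1 + (K + B) * Real.exp K) * ‖h₁ - h₂‖ := by
  have h1 := abs_descent_sub_le (p₁ := p) (p₂ := p) (h₂ := h₂) hG hh
  rw [show leafPoint G e p h₁ - leafPoint G e p h₂
    = (h₁ - h₂) - (descent G e p h₁ - descent G e p h₂) • e by unfold leafPoint; module]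
  refine (norm_sub_le _ _).trans ?_
  rw [norm_smul, hG.norm_e, mul_one, Real.norm_eq_abs]
  simp only [sub_self, norm_zero, mul_zero, zero_add] at h1
  linarith

/-- In an almost flat field the derivative of the end point with respect to the direction is almost
horizontal. The deviation `ρ(t) = σ'(t) - σ(t) - t ⟪A(y(t)), k⟫` of two neighbouring horizontal
curves satisfies a linear differential inequality whose inhomogeneity is the curvature `κ`, up to
terms quadratic in `k`. -/
theorem IsAlmostFlat.abs_descent_sub_sub_le_local {D : Set E}
    (hA : IsAlmostFlat A A' e K B M κ D) (hq : ‖q‖ ≤ 1) (hqk : ‖q + k‖ ≤ 1)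
    (hD : ∀ t ∈ Icc (0 : ℝ) 1, p + t • q - horizontalCurve A e p q t • e ∈ D) :
    |descent A e p (q + k) - descent A e p q - ⟪A (leafPoint A e p q), k⟫| ≤
      (κ * ‖k‖ + (M * (1 + (K + B) * Real.exp K) ^ 2 + K * (1 + (K + B) * Real.exp K)) *
        ‖k‖ ^ 2) * Real.exp K := by
  have hT := hA.transversal
  have hK := hT.K_nonneg
  have hB := hT.B_nonneg
  have hM := hA.M_nonneg
  have hκ := hA.κ_nonneg
  set σ := horizontalCurve A e p q with hσ
  set τ := horizontalCurve A e p (q + k) with hτ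
  have sσ : IsHorizontal A e p q σ := isHorizontal_horizontalCurve hT p q
  have sτ : IsHorizontal A e p (q + k) τ := isHorizontal_horizontalCurve hT p (q + k)
  set C := 1 + (K + B) * Real.exp K with hC
  have hC0 : 0 ≤ C := by positivity
  set y : ℝ → E := fun t => p + t • q - σ t • e with hy
  set z : ℝ → E := fun t => p + t • (q + k) - τ t • e with hz
  have hzy : ∀ t ∈ Icc (0 : ℝ) 1, ‖z t - y t‖ ≤ C * ‖k‖ := by
    intro t ht
    have h1 := IsHorizontal.abs_sub_le (δ := 0) hT (by simp) hqk sτ sσ t ht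
    simp only [sub_self, norm_zero, mul_zero, zero_add, add_sub_cancel_left] at h1
    rw [show z t - y t = t • k - (τ t - σ t) • e by simp only [hz, hy]; module]
    refine (norm_sub_le _ _).trans ?_
    rw [norm_smul, norm_smul, hT.norm_e, mul_one, Real.norm_eq_abs, Real.norm_eq_abs,
      abs_of_nonneg ht.1]
    have := mul_le_of_le_one_left (norm_nonneg k) ht.2
    rw [hC]
    linarith
  have hyd : ∀ t ∈ Icc (0 : ℝ) 1, HasDerivAt y (q - ⟪A (y t), q⟫ • e) t := by
    intro t ht
    have := (((hasDerivAt_id t).smul_const q).const_add p).sub ((sσ.deriv t ht).smul_const e)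
    rw [one_smul] at this
    exact this
  have hd : ∀ t ∈ Icc (0 : ℝ) 1, HasDerivAt (fun t => τ t - σ t - t * ⟪A (y t), k⟫)
      (⟪A (z t), q + k⟫ - ⟪A (y t), q⟫ - (⟪A (y t), k⟫ +
        t * ⟪A' (y t) (q - ⟪A (y t), q⟫ • e), k⟫)) t := by
    intro t ht
    have h1 : HasDerivAt (fun t => A (y t)) (A' (y t) (q - ⟪A (y t), q⟫ • e)) t :=
      (hA.hasFDerivAt (y t)).comp_hasDerivAt t (hyd t ht)
    have h2 : HasDerivAt (fun t => ⟪A (y t), k⟫)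
        ⟪A' (y t) (q - ⟪A (y t), q⟫ • e), k⟫ t := by
      simpa using h1.inner ℝ (hasDerivAt_const t k)
    have h3 := (hasDerivAt_id t).mul h2
    rw [one_mul] at h3
    exact ((sτ.deriv t ht).sub (sσ.deriv t ht)).sub h3
  have hbound : ∀ t ∈ Icc (0 : ℝ) 1,
      |⟪A (z t), q + k⟫ - ⟪A (y t), q⟫ - (⟪A (y t), k⟫ +
        t * ⟪A' (y t) (q - ⟪A (y t), q⟫ • e), k⟫)| ≤
      K * |τ t - σ t - t * ⟪A (y t), k⟫| + (κ * ‖k‖ + (M * C ^ 2 + K * C) * ‖k‖ ^ 2) := by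
    intro t ht
    set ρ := τ t - σ t - t * ⟪A (y t), k⟫ with hρ
    have hdiff : z t - y t = t • (k - ⟪A (y t), k⟫ • e) - ρ • e := by
      simp only [hz, hy, hρ]; module
    set w := A (z t) - A (y t) - A' (y t) (z t - y t) with hw
    have e1 : ⟪A (z t), q + k⟫ - ⟪A (y t), q⟫ - (⟪A (y t), k⟫ +
        t * ⟪A' (y t) (q - ⟪A (y t), q⟫ • e), k⟫)
        = t * curvature e (A (y t)) (A' (y t)) k q - ρ * ⟪A' (y t) e, q⟫ + ⟪w, q⟫
          + ⟪A (z t) - A (y t), k⟫ := by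
      have hAz : A (z t) = A (y t) + A' (y t) (t • (k - ⟪A (y t), k⟫ • e) - ρ • e) + w := by
        rw [← hdiff, hw]; abel
      have h5 : ⟪A (z t), q⟫ = ⟪A (y t), q⟫ + t * ⟪A' (y t) (k - ⟪A (y t), k⟫ • e), q⟫
          - ρ * ⟪A' (y t) e, q⟫ + ⟪w, q⟫ := by
        rw [hAz, map_sub, map_smul, map_smul, inner_add_left, inner_add_left, inner_sub_left,
          real_inner_smul_left, real_inner_smul_left]
        ring
      unfold curvature
      rw [inner_add_right, h5, inner_sub_left (A (z t)) (A (y t)) k]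
      ring
    have b1 : |t * curvature e (A (y t)) (A' (y t)) k q| ≤ κ * ‖k‖ := by
      rw [abs_mul, abs_of_nonneg ht.1]
      refine (mul_le_of_le_one_left (abs_nonneg _) ht.2).trans ?_
      exact (hA.curvature_le _ (hD t ht) k q).trans (mul_le_of_le_one_right (by positivity) hq)
    have b2 : |ρ * ⟪A' (y t) e, q⟫| ≤ K * |ρ| := by
      rw [abs_mul, mul_comm K]
      refine mul_le_mul_of_nonneg_left ((abs_real_inner_le_norm _ _).trans ?_) (abs_nonneg _)
      refine (mul_le_of_le_one_right (norm_nonneg _) hq).trans ?_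
      exact ((A' (y t)).le_of_opNorm_le (hA.norm_deriv_le _) e).trans (by rw [hT.norm_e, mul_one])
    have b3 : |⟪w, q⟫| ≤ M * C ^ 2 * ‖k‖ ^ 2 := by
      refine (abs_real_inner_le_norm _ _).trans ?_
      refine (mul_le_of_le_one_right (norm_nonneg _) hq).trans ?_
      refine (hA.taylor (y t) (z t)).trans ?_
      rw [mul_assoc, ← mul_pow]
      have := hzy t ht
      gcongr
    have b4 : |⟪A (z t) - A (y t), k⟫| ≤ K * C * ‖k‖ ^ 2 := by
      refine (abs_real_inner_le_norm _ _).trans ?_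
      have := (hT.lip (z t) (y t)).trans (mul_le_mul_of_nonneg_left (hzy t ht) hK)
      calc _ ≤ K * (C * ‖k‖) * ‖k‖ := by gcongr
        _ = _ := by ring
    rw [e1]
    have t1 := abs_add_le (t * curvature e (A (y t)) (A' (y t)) k q - ρ * ⟪A' (y t) e, q⟫
      + ⟪w, q⟫) ⟪A (z t) - A (y t), k⟫
    have t2 := abs_add_le (t * curvature e (A (y t)) (A' (y t)) k q - ρ * ⟪A' (y t) e, q⟫) ⟪w, q⟫
    have t3 := abs_sub (t * curvature e (A (y t)) (A' (y t)) k q) (ρ * ⟪A' (y t) e, q⟫)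
    linarith
  have := norm_le_of_norm_deriv_le hK le_rfl (by positivity) hd
    (by simp [sσ.zero, sτ.zero]) hbound 1 (by simp)
  simp only [zero_add, one_mul] at this
  have hy1 : y 1 = leafPoint A e p q := by simp [hy, leafPoint, descent, hσ]
  rw [hy1] at this
  exact this

/-- The local estimate, summed over a subdivision of the segment from `q` to `q + k`: the quadratic
error, whose constant involves second derivatives of `A`, disappears. -/
theorem IsAlmostFlat.abs_descent_sub_sub_le
    (hA : IsAlmostFlat A A' e K B M κ (Metric.ball x₀ R)) (hr1 : r ≤ 1)
    (hr : ‖p - x₀‖ + (1 + B) * r < R) (hq : ‖q‖ ≤ r) (hqk : ‖q + k‖ ≤ r) :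
    |descent A e p (q + k) - descent A e p q - ⟪A (leafPoint A e p q), k⟫| ≤
      κ * ‖k‖ * Real.exp K + K * (1 + (K + B) * Real.exp K) * ‖k‖ ^ 2 := by
  have hT := hA.transversal
  have hK := hT.K_nonneg
  have hB := hT.B_nonneg
  set C := 1 + (K + B) * Real.exp K with hC
  have hC0 : 0 ≤ C := by positivity
  have hseg : ∀ x ∈ Icc (0 : ℝ) 1, ‖q + x • k‖ ≤ r := by
    intro x hx
    have h1 : q + x • k = (1 - x) • q + x • (q + k) := by module
    rw [h1]
    refine (norm_add_le _ _).trans ?_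
    rw [norm_smul, norm_smul, Real.norm_of_nonneg hx.1, Real.norm_of_nonneg (by linarith [hx.2])]
    nlinarith [hx.1, hx.2]
  have hD : ∀ v, ‖v‖ ≤ r → ∀ t ∈ Icc (0 : ℝ) 1,
      p + t • v - horizontalCurve A e p v t • e ∈ Metric.ball x₀ R := by
    intro v hv t ht
    rw [Metric.mem_ball, dist_eq_norm]
    rw [show p + t • v - horizontalCurve A e p v t • e - x₀
      = (p - x₀) + t • v - horizontalCurve A e p v t • e by abel]
    have h1 := norm_sub_le (p - x₀ + t • v) (horizontalCurve A e p v t • e)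
    have h2 := norm_add_le (p - x₀) (t • v)
    have h3 := (isHorizontal_horizontalCurve hT p v).abs_le hT t ht
    rw [norm_smul, hT.norm_e, mul_one, Real.norm_eq_abs] at h1
    rw [norm_smul, Real.norm_of_nonneg ht.1] at h2
    have h4 := mul_le_of_le_one_left (norm_nonneg v) ht.2
    have h5 : B * ‖v‖ ≤ B * r := by gcongr
    linarith
  have key := abs_sub_le_of_quadratic
    (f := fun x => descent A e p (q + x • k) - x * ⟪A (leafPoint A e p q), k⟫)
    (c := κ * ‖k‖ * Real.exp K + K * C * ‖k‖ ^ 2)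
    (M := (M * C ^ 2 + K * C) * ‖k‖ ^ 2 * Real.exp K) (by
      intro x hx y hy
      have h1 := hA.abs_descent_sub_sub_le_local (p := p) (q := q + x • k) (k := (y - x) • k)
        ((hseg x hx).trans hr1)
        (by rw [show q + x • k + (y - x) • k = q + y • k by module]
            exact (hseg y hy).trans hr1) (hD _ (hseg x hx))
      rw [show q + x • k + (y - x) • k = q + y • k by module, ← hC, norm_smul,
        Real.norm_eq_abs, real_inner_smul_right] at h1
      have h2 : |⟪A (leafPoint A e p (q + x • k)) - A (leafPoint A e p q), k⟫|
          ≤ K * C * ‖k‖ ^ 2 := by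
        refine (abs_real_inner_le_norm _ _).trans ?_
        have h3 := norm_leafPoint_sub_le (p := p) (h₁ := q + x • k) (h₂ := q) hT
          ((hseg x hx).trans hr1)
        rw [add_sub_cancel_left, norm_smul, Real.norm_of_nonneg hx.1, ← hC] at h3
        have h4 : C * (x * ‖k‖) ≤ C * ‖k‖ := by
          gcongr
          exact mul_le_of_le_one_left (norm_nonneg k) hx.2
        have h5 := (hT.lip (leafPoint A e p (q + x • k)) (leafPoint A e p q)).trans
          (mul_le_mul_of_nonneg_left (h3.trans h4) hK)
        calc _ ≤ K * (C * ‖k‖) * ‖k‖ := by gcongr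
          _ = _ := by ring
      have h6 : (descent A e p (q + y • k) - y * ⟪A (leafPoint A e p q), k⟫) -
          (descent A e p (q + x • k) - x * ⟪A (leafPoint A e p q), k⟫) =
          (descent A e p (q + y • k) - descent A e p (q + x • k) -
            (y - x) * ⟪A (leafPoint A e p (q + x • k)), k⟫) + (y - x) *
            ⟪A (leafPoint A e p (q + x • k)) - A (leafPoint A e p q), k⟫ := by
        rw [inner_sub_left]; ring
      rw [h6]
      refine (abs_add_le _ _).trans ?_
      rw [abs_mul (y - x) ⟪A (leafPoint A e p (q + x • k)) - A (leafPoint A e p q), k⟫]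
      have h7 := mul_le_mul_of_nonneg_left h2 (abs_nonneg (y - x))
      refine (add_le_add h1 h7).trans (le_of_eq ?_)
      ring)
  simp only [one_smul, one_mul, zero_smul, add_zero, zero_mul, sub_zero] at key
  rw [show descent A e p (q + k) - descent A e p q - ⟪A (leafPoint A e p q), k⟫
    = descent A e p (q + k) - ⟪A (leafPoint A e p q), k⟫ - descent A e p q by ring]
  exact key

variable [FiniteDimensional ℝ E] [MeasurableSpace E] [BorelSpace E]

/-- Frobenius' theorem for flat Lipschitz fields, as a quantitative estimate: the end points of the
horizontal curves that issue from `p` form a surface tangent to the field. -/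
theorem abs_descent_sub_sub_le_of_flat (hG : IsTransversal G e K B)
    (hflat : ∀ᵐ x ∂(volume.restrict (Metric.ball x₀ R)),
      ∀ a b, curvature e (G x) (fderiv ℝ G x) a b = 0) (hr1 : r ≤ 1)
    (hr : ‖p - x₀‖ + (1 + B) * r < R / 2) (hq : ‖q‖ ≤ r) (hqk : ‖q + k‖ ≤ r) :
    |descent G e p (q + k) - descent G e p q - ⟪G (leafPoint G e p q), k⟫| ≤
      K * (1 + (K + B) * Real.exp K) * ‖k‖ ^ 2 := by
  have hK := hG.K_nonneg
  have hB := hG.B_nonneg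
  have hr0 : 0 ≤ r := (norm_nonneg _).trans hq
  have hR : 0 < R / 2 := lt_of_le_of_lt (by positivity) hr
  set Q := 4 * K ^ 2 * ‖k‖ * Real.exp K + 2 * (K * Real.exp K) +
    (K + K * (K * Real.exp K)) * ‖k‖ with hQ
  have key : ∀ ε ∈ Ioo 0 (R / 2),
      |descent G e p (q + k) - descent G e p q - ⟪G (leafPoint G e p q), k⟫| ≤
      K * (1 + (K + B) * Real.exp K) * ‖k‖ ^ 2 + Q * ε := by
    intro ε hε
    obtain ⟨A, A', M, hA, hAG⟩ := exists_isAlmostFlat hG hflat hε.1 hε.2.le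
    have hT := hA.transversal
    have h1 := hA.abs_descent_sub_sub_le hr1 hr hq hqk
    have hd : ∀ v, ‖v‖ ≤ r → |descent A e p v - descent G e p v| ≤ K * ε * Real.exp K := by
      intro v hv
      have := IsHorizontal.abs_sub_le hG hAG (hv.trans hr1)
        (isHorizontal_horizontalCurve hT p v) (isHorizontal_horizontalCurve hG p v) 1 (by simp)
      simpa [descent] using this
    have h2 := hd _ hq
    have h3 := hd _ hqk
    have h4 : ‖leafPoint A e p q - leafPoint G e p q‖ ≤ K * ε * Real.exp K := by
      rw [show leafPoint A e p q - leafPoint G e p q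
        = -((descent A e p q - descent G e p q) • e) by unfold leafPoint; module, norm_neg,
        norm_smul, hG.norm_e, mul_one]
      exact h2
    have h5 : |⟪A (leafPoint A e p q) - G (leafPoint G e p q), k⟫| ≤
        (K * ε + K * (K * ε * Real.exp K)) * ‖k‖ := by
      refine (abs_real_inner_le_norm _ _).trans ?_
      gcongr
      refine (norm_sub_le_norm_sub_add_norm_sub _ (G (leafPoint A e p q)) _).trans ?_
      have := (hG.lip (leafPoint A e p q) (leafPoint G e p q)).trans
        (mul_le_mul_of_nonneg_left h4 hK)
      linarith [hAG (leafPoint A e p q)]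
    rw [inner_sub_left] at h5
    rw [abs_le] at h1 h2 h3 h5 ⊢
    rw [hQ]
    constructor <;> nlinarith
  have hlim : Tendsto (fun ε => K * (1 + (K + B) * Real.exp K) * ‖k‖ ^ 2 + Q * ε) (𝓝[>] 0)
      (𝓝 (K * (1 + (K + B) * Real.exp K) * ‖k‖ ^ 2 + Q * 0)) :=
    tendsto_nhdsWithin_of_tendsto_nhds (Continuous.tendsto (by fun_prop) 0)
  rw [mul_zero, add_zero] at hlim
  refine ge_of_tendsto hlim ?_
  filter_upwards [Ioo_mem_nhdsGT hR] with ε hε using key ε hε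

/-- The derivative of the descent with respect to the direction. -/
theorem hasFDerivAt_descent (hG : IsTransversal G e K B)
    (hflat : ∀ᵐ x ∂(volume.restrict (Metric.ball x₀ R)),
      ∀ a b, curvature e (G x) (fderiv ℝ G x) a b = 0) (hr1 : r ≤ 1)
    (hr : ‖p - x₀‖ + (1 + B) * r < R / 2) (hq : ‖q‖ < r) :
    HasFDerivAt (descent G e p) (innerSL ℝ (G (leafPoint G e p q))) q := by
  rw [hasFDerivAt_iff_isLittleO_nhds_zero]
  have hbig : (fun k => descent G e p (q + k) - descent G e p q -
      innerSL ℝ (G (leafPoint G e p q)) k) =O[𝓝 0] fun k => ‖k‖ ^ 2 := by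
    refine Asymptotics.IsBigO.of_bound (K * (1 + (K + B) * Real.exp K)) ?_
    have hc : Continuous fun k : E => ‖q + k‖ := by fun_prop
    have hev : ∀ᶠ k in 𝓝 (0 : E), ‖q + k‖ < r :=
      hc.continuousAt.eventually_lt continuousAt_const (by simpa using hq)
    filter_upwards [hev] with k hk
    have := abs_descent_sub_sub_le_of_flat hG hflat hr1 hr hq.le hk.le
    simpa using this
  exact hbig.trans_isLittleO (by
    simpa using (Asymptotics.isLittleO_norm_pow_id (E' := E) one_lt_two))

/-- The descent is continuously differentiable in the direction. -/
theorem contDiffOn_descent (hG : IsTransversal G e K B)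
    (hflat : ∀ᵐ x ∂(volume.restrict (Metric.ball x₀ R)),
      ∀ a b, curvature e (G x) (fderiv ℝ G x) a b = 0) (hr1 : r ≤ 1)
    (hr : ‖p - x₀‖ + (1 + B) * r < R / 2) :
    ContDiffOn ℝ 1 (descent G e p) (Metric.ball 0 r) := by
  have hd : ∀ q ∈ Metric.ball (0 : E) r,
      HasFDerivAt (descent G e p) (innerSL ℝ (G (leafPoint G e p q))) q := fun q hq =>
    hasFDerivAt_descent hG hflat hr1 hr (by simpa using hq)
  rw [show (1 : WithTop ℕ∞) = 0 + 1 from rfl, contDiffOn_succ_iff_fderiv_of_isOpen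
    Metric.isOpen_ball]
  refine ⟨fun q hq => (hd q hq).differentiableAt.differentiableWithinAt, by simp, ?_⟩
  rw [contDiffOn_zero]
  have hc : ContinuousOn (descent G e p) (Metric.ball 0 r) := fun q hq =>
    (hd q hq).continuousAt.continuousWithinAt
  have hc2 : ContinuousOn (fun q => innerSL ℝ (G (leafPoint G e p q))) (Metric.ball 0 r) := by
    refine (innerSL ℝ).continuous.comp_continuousOn (hG.continuous.comp_continuousOn ?_)
    unfold leafPoint
    fun_prop
  exact hc2.congr fun q hq => (hd q hq).fderiv

end Frobenius

/-! ### Leaf functions -/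

section LeafFunction

variable {E : Type*} [NormedAddCommGroup E] [InnerProductSpace ℝ E]

/-- A `C¹` local defining function `T` of the level set of `u` through `z`. The value `T x` is the
signed distance along `e` from `x` to the level set, on which `x - T x • e` lies, and the sign of
`T` is that of `u - u z`. The last condition says that the level set is orthogonal to `g`. -/
structure IsLeafFunction (g : E → E) (u : E → ℝ) (e z : E) (T : E → ℝ) : Prop where
  inner_pos : 0 < ⟪g z, e⟫
  contDiffAt : ∀ᶠ x in 𝓝 z, ContDiffAt ℝ 1 T x
  pos_iff : ∀ᶠ x in 𝓝 z, 0 < T x ↔ u z < u x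
  neg_iff : ∀ᶠ x in 𝓝 z, T x < 0 ↔ u x < u z
  orthogonal : ∀ᶠ x in 𝓝 z, ∀ h, ⟪g (x - T x • e), h - fderiv ℝ T x h • e⟫ = 0

variable {g : E → E} {u T : E → ℝ} {e z v : E}

theorem IsLeafFunction.apply_self (h : IsLeafFunction g u e z T) : T z = 0 := by
  have h1 := h.pos_iff.self_of_nhds
  have h2 := h.neg_iff.self_of_nhds
  simp only [lt_self_iff_false, iff_false, not_lt] at h1 h2
  exact le_antisymm h1 h2

theorem IsLeafFunction.hasDerivAt (h : IsLeafFunction g u e z T) (v : E) :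
    HasDerivAt (fun s : ℝ => T (z + s • v)) (⟪g z, v⟫ / ⟪g z, e⟫) 0 := by
  have h1 := h.contDiffAt.self_of_nhds.differentiableAt one_ne_zero
  have h2 := h.orthogonal.self_of_nhds v
  rw [h.apply_self, zero_smul, sub_zero, inner_sub_right, inner_smul_right] at h2
  have h3 : fderiv ℝ T z v = ⟪g z, v⟫ / ⟪g z, e⟫ := by
    rw [eq_div_iff h.inner_pos.ne']; linarith
  have h4 : HasDerivAt (fun s : ℝ => z + s • v) v 0 := by
    simpa using ((hasDerivAt_id (0 : ℝ)).smul_const v).const_add z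
  have h5 : HasFDerivAt T (fderiv ℝ T z) (z + (0 : ℝ) • v) := by
    simpa using h1.hasFDerivAt
  rw [← h3]
  exact h5.comp_hasDerivAt 0 h4

theorem tendsto_add_smul_nhdsGT (z v : E) :
    Tendsto (fun s : ℝ => z + s • v) (𝓝[>] 0) (𝓝 z) := by
  have : Tendsto (fun s : ℝ => z + s • v) (𝓝 0) (𝓝 (z + (0 : ℝ) • v)) :=
    Continuous.tendsto (by fun_prop) 0
  rw [zero_smul, add_zero] at this
  exact this.mono_left nhdsWithin_le_nhds

/-- `u` increases strictly in every direction that makes an acute angle with `g`. -/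
theorem IsLeafFunction.eventually_lt (h : IsLeafFunction g u e z T) (hv : 0 < ⟪g z, v⟫) :
    ∀ᶠ s in 𝓝[>] (0 : ℝ), u z < u (z + s • v) := by
  have h1 := (hasDerivAt_iff_tendsto_slope.1 (h.hasDerivAt v)).eventually_const_lt
    (div_pos hv h.inner_pos)
  have h2 : 𝓝[>] (0 : ℝ) ≤ 𝓝[≠] 0 := nhdsWithin_mono _ fun s hs => ne_of_gt hs
  filter_upwards [h2 h1, (tendsto_add_smul_nhdsGT z v).eventually h.pos_iff,
    self_mem_nhdsWithin] with s hs1 hs2 hs3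
  refine hs2.1 ?_
  rw [slope_def_field] at hs1
  simp only [zero_smul, add_zero, sub_zero, h.apply_self] at hs1
  exact (div_pos_iff_of_pos_right hs3).1 hs1

/-- `IsLeafFunction.eventually_lt` at an arbitrary parameter of a line. -/
theorem IsLeafFunction.eventually_lt_line {t : ℝ} (h : IsLeafFunction g u e (z + t • v) T)
    (hv : 0 < ⟪g (z + t • v), v⟫) : ∀ᶠ s in 𝓝[>] t, u (z + t • v) < u (z + s • v) := by
  have h2 : Tendsto (fun s : ℝ => s - t) (𝓝[>] t) (𝓝[>] 0) := by
    refine tendsto_nhdsWithin_of_tendsto_nhds_of_eventually_within _ ?_ ?_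
    · have : Continuous fun s : ℝ => s - t := by fun_prop
      have := this.tendsto t
      rw [sub_self] at this
      exact this.mono_left nhdsWithin_le_nhds
    · filter_upwards [self_mem_nhdsWithin] with s hs using sub_pos.2 (mem_Ioi.1 hs)
  refine (h2.eventually (h.eventually_lt hv)).mono fun s hs => ?_
  rwa [show z + t • v + (s - t) • v = z + s • v by module] at hs

end LeafFunction

/-! ### The local solution attached to a flat field -/

section LocalSolution

variable {E : Type*} [NormedAddCommGroup E] [InnerProductSpace ℝ E]

/-- The function which is constant on the leaves of the field near `x₀`, normalised by
`x₀ + s e ↦ s`: follow the horizontal curve from `x` until it meets the line `x₀ + ℝ e`. -/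
def leafHeight (G : E → E) (e x₀ x : E) : ℝ := -descent G e x (x₀ - x)

/-- The signed distance along `e` of `x` from the leaf through `x₀ + s e`. -/
def leafGap (G : E → E) (e x₀ : E) (s : ℝ) (x : E) : ℝ := descent G e (x₀ + s • e) (x - x₀) - s

variable {G : E → E} {e x₀ x y : E} {K B R δ s τ : ℝ}

theorem leafHeight_eq_iff (hG : IsTransversal G e K B) (hx : ‖x - x₀‖ ≤ 1) :
    leafHeight G e x₀ x = s ↔ leafGap G e x₀ s x = 0 := by
  unfold leafHeight leafGap
  constructor
  · intro h
    have h1 := descent_reverse (p := x) (h := x₀ - x) hG (by rwa [norm_sub_rev])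
    rw [h, neg_sub, show x + (x₀ - x) - descent G e x (x₀ - x) • e = x₀ + s • e by
      rw [← h]; module] at h1
    rw [h1, sub_self]
  · intro h
    have h0 : descent G e (x₀ + s • e) (x - x₀) = s := by linarith
    have h1 := descent_reverse (p := x₀ + s • e) (h := x - x₀) hG hx
    rw [h0, neg_sub, show x₀ + s • e + (x - x₀) - s • e = x by abel] at h1
    rw [h1, neg_neg]

theorem leafGap_add_smul (hG : IsTransversal G e K B) (hx : ‖x + τ • e - x₀‖ ≤ 1) :
    leafGap G e x₀ s (x + τ • e) = leafGap G e x₀ s x + τ := by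
  unfold leafGap
  rw [show x + τ • e - x₀ = x - x₀ + τ • e by abel] at hx ⊢
  rw [descent_add_smul hG hx]
  ring

theorem leafHeight_add_le (hG : IsTransversal G e K B) (hx : ‖x - x₀‖ ≤ 1)
    (hx' : ‖x + τ • e - x₀‖ ≤ 1) (hτ : 0 < τ) :
    leafHeight G e x₀ x + τ * Real.exp (-K) ≤ leafHeight G e x₀ (x + τ • e) := by
  have hx1 : ‖x₀ - x‖ ≤ 1 := by rwa [norm_sub_rev]
  have h1 := (isHorizontal_horizontalCurve hG x (x₀ - x)).gap hG hx1 hτ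
    (isHorizontal_horizontalCurve hG (x + τ • e) (x₀ - x))
  have h2 : descent G e (x + τ • e) (x₀ - (x + τ • e))
      = descent G e (x + τ • e) (x₀ - x) - τ := by
    have h3 : x₀ - (x + τ • e) = x₀ - x + (-τ) • e := by module
    rw [h3, descent_add_smul hG (by rw [← h3, norm_sub_rev]; exact hx')]
    ring
  unfold leafHeight
  rw [h2]
  change τ ≤ (τ + descent G e x (x₀ - x) - descent G e (x + τ • e) (x₀ - x)) * Real.exp K at h1
  have h4 : Real.exp (-K) * Real.exp K = 1 := by rw [← Real.exp_add]; simp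
  have h5 := mul_le_mul_of_nonneg_right h1 (Real.exp_pos (-K)).le
  rw [mul_assoc, mul_comm (Real.exp K), h4, mul_one] at h5
  linarith

theorem abs_leafHeight_le (hG : IsTransversal G e K B) :
    |leafHeight G e x₀ x| ≤ B * ‖x - x₀‖ := by
  unfold leafHeight
  rw [abs_neg, norm_sub_rev]
  exact abs_descent_le hG

theorem abs_leafGap_le (hG : IsTransversal G e K B) :
    |leafGap G e x₀ s x| ≤ B * ‖x - x₀‖ + |s| := by
  unfold leafGap
  exact (abs_sub _ _).trans (add_le_add_left (abs_descent_le hG) _)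

theorem abs_leafHeight_sub_le (hG : IsTransversal G e K B) (hx : ‖x - x₀‖ ≤ 1) :
    |leafHeight G e x₀ x - leafHeight G e x₀ y| ≤ (2 * K + B) * Real.exp K * ‖x - y‖ := by
  unfold leafHeight
  have h := abs_descent_sub_le (p₁ := x) (p₂ := y) (h₁ := x₀ - x) (h₂ := x₀ - y) hG
    (by rwa [norm_sub_rev])
  rw [sub_sub_sub_cancel_left, norm_sub_rev y x] at h
  rw [neg_sub_neg, abs_sub_comm]
  linarith

theorem leafHeight_trichotomy (hG : IsTransversal G e K B) (hδ : (1 + 2 * B) * δ ≤ 1)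
    (hs : |s| ≤ B * δ) (hx : ‖x - x₀‖ ≤ δ) :
    (0 < leafGap G e x₀ s x ↔ s < leafHeight G e x₀ x) ∧
      (leafGap G e x₀ s x < 0 ↔ leafHeight G e x₀ x < s) := by
  have hB := hG.B_nonneg
  have hδ0 : 0 ≤ δ := (norm_nonneg _).trans hx
  set t := leafGap G e x₀ s x with ht
  have ht1 : |t| ≤ 2 * B * δ := by
    have h1 := abs_leafGap_le (x := x) (x₀ := x₀) (s := s) hG
    have h2 : B * ‖x - x₀‖ ≤ B * δ := by gcongr
    linarith
  have hx1 : ‖x - x₀‖ ≤ 1 := hx.trans (by nlinarith)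
  have hx' : ‖x + (-t) • e - x₀‖ ≤ 1 := by
    rw [show x + (-t) • e - x₀ = (x - x₀) - t • e by module]
    refine (norm_sub_le _ _).trans ?_
    rw [norm_smul, hG.norm_e, mul_one, Real.norm_eq_abs]
    linarith
  have h0 : leafHeight G e x₀ (x + (-t) • e) = s := by
    rw [leafHeight_eq_iff hG hx', leafGap_add_smul hG hx', ← ht]; ring
  have hpos : 0 < t → s < leafHeight G e x₀ x := by
    intro h
    have hx2 : x + (-t) • e + t • e = x := by module
    have h1 := leafHeight_add_le (x := x + (-t) • e) hG hx' (by rwa [hx2]) h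
    rw [hx2, h0] at h1
    have := mul_pos h (Real.exp_pos (-K))
    linarith
  have hneg : t < 0 → leafHeight G e x₀ x < s := by
    intro h
    have h1 := leafHeight_add_le (x := x) hG hx1 hx' (neg_pos.2 h)
    rw [h0] at h1
    have := mul_pos (neg_pos.2 h) (Real.exp_pos (-K))
    linarith
  have hzero : t = 0 → leafHeight G e x₀ x = s := fun h => (leafHeight_eq_iff hG hx1).2 h
  rcases lt_trichotomy t 0 with h | h | h
  · have := hneg h
    constructor <;> constructor <;> intro <;> linarith
  · have := hzero h
    constructor <;> constructor <;> intro <;> linarith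
  · have := hpos h
    constructor <;> constructor <;> intro <;> linarith

theorem sub_leafGap_smul_eq_leafPoint :
    x - leafGap G e x₀ s x • e = leafPoint G e (x₀ + s • e) (x - x₀) := by
  unfold leafGap leafPoint; module

variable [FiniteDimensional ℝ E] [MeasurableSpace E] [BorelSpace E]

theorem hasFDerivAt_leafGap (hG : IsTransversal G e K B)
    (hflat : ∀ᵐ x ∂(volume.restrict (Metric.ball x₀ R)),
      ∀ a b, curvature e (G x) (fderiv ℝ G x) a b = 0) (hδ1 : δ ≤ 1)
    (hδ : (1 + 2 * B) * δ < R / 2) (hs : |s| ≤ B * δ) (hx : ‖x - x₀‖ < δ) :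
    HasFDerivAt (leafGap G e x₀ s) (innerSL ℝ (G (x - leafGap G e x₀ s x • e))) x ∧
      ContDiffAt ℝ 1 (leafGap G e x₀ s) x := by
  have hp : ‖x₀ + s • e - x₀‖ + (1 + B) * δ < R / 2 := by
    rw [add_sub_cancel_left, norm_smul, hG.norm_e, mul_one, Real.norm_eq_abs]
    linarith
  constructor
  · have h1 := hasFDerivAt_descent hG hflat hδ1 hp hx
    rw [sub_leafGap_smul_eq_leafPoint]
    exact (h1.comp x ((hasFDerivAt_id x).sub_const x₀)).sub_const s
  · have h1 := (contDiffOn_descent hG hflat hδ1 hp).contDiffAt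
      (Metric.isOpen_ball.mem_nhds (by simpa using hx : x - x₀ ∈ Metric.ball 0 δ))
    exact (h1.comp x (contDiffAt_id.sub contDiffAt_const)).sub contDiffAt_const

theorem isLeafFunction_leafGap {g : E → E} {z : E} (hG : IsTransversal G e K B)
    (hflat : ∀ᵐ x ∂(volume.restrict (Metric.ball x₀ R)),
      ∀ a b, curvature e (G x) (fderiv ℝ G x) a b = 0)
    (hg : ∀ x ∈ Metric.ball x₀ R, 0 < ⟪g x, e⟫ ∧ g x = ⟪g x, e⟫ • G x)
    (hδ1 : (1 + 2 * B) * δ ≤ 1) (hδ : (1 + 2 * B) * δ < R / 2) (hz : ‖z - x₀‖ < δ) :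
    IsLeafFunction g (leafHeight G e x₀) e z (leafGap G e x₀ (leafHeight G e x₀ z)) := by
  have hB := hG.B_nonneg
  have hδ0 : 0 < δ := lt_of_le_of_lt (norm_nonneg _) hz
  have hs : |leafHeight G e x₀ z| ≤ B * δ := (abs_leafHeight_le hG).trans (by gcongr)
  have hnhds : ∀ᶠ x in 𝓝 z, ‖x - x₀‖ < δ := by
    have : ContinuousAt (fun x => ‖x - x₀‖) z := by fun_prop
    exact this.eventually_lt continuousAt_const hz
  have hδ' : δ ≤ 1 := by nlinarith
  refine ⟨(hg z ?_).1, ?_, ?_, ?_, ?_⟩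
  · rw [Metric.mem_ball, dist_eq_norm]; nlinarith
  · filter_upwards [hnhds] with x hx using (hasFDerivAt_leafGap hG hflat hδ' hδ hs hx).2
  · filter_upwards [hnhds] with x hx using (leafHeight_trichotomy hG hδ1 hs hx.le).1
  · filter_upwards [hnhds] with x hx using (leafHeight_trichotomy hG hδ1 hs hx.le).2
  · filter_upwards [hnhds] with x hx h
    rw [(hasFDerivAt_leafGap hG hflat hδ' hδ hs hx).1.fderiv]
    set t := leafGap G e x₀ (leafHeight G e x₀ z) x with ht
    have hmem : x - t • e ∈ Metric.ball x₀ R := by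
      rw [Metric.mem_ball, dist_eq_norm, show x - t • e - x₀ = (x - x₀) - t • e by abel]
      have h1 := abs_leafGap_le (x := x) (x₀ := x₀) (s := leafHeight G e x₀ z) hG
      have h2 : B * ‖x - x₀‖ ≤ B * δ := by gcongr
      refine (norm_sub_le _ _).trans_lt ?_
      rw [norm_smul, hG.norm_e, mul_one, Real.norm_eq_abs]
      nlinarith
    rw [(hg _ hmem).2, real_inner_smul_left, inner_sub_right, inner_smul_right, hG.inner_e,
      innerSL_apply_apply]
    ring

end LocalSolution

/-! ### The local solution is regular -/

theorem IsC1On.contDiffAt {N M : ℕ} {W : Set (Euc N)} {φ : Euc N → Euc M} (hφ : IsC1On W φ)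
    (hW : IsOpen W) {w : Euc N} (hw : w ∈ W) : ContDiffAt ℝ 1 φ w := by
  obtain ⟨r, hr, F, hF, hFφ⟩ := hφ w hw
  refine (hF.contDiffAt (Metric.ball_mem_nhds w hr)).congr_of_eventuallyEq ?_
  filter_upwards [hW.mem_nhds hw, Metric.ball_mem_nhds w hr] with y hy1 hy2
  exact (hFφ y ⟨hy1, hy2⟩).symm

theorem isC1On_of_contDiffOn {N M : ℕ} {W : Set (Euc N)} {φ : Euc N → Euc M}
    (hφ : ContDiffOn ℝ 1 φ W) (hW : IsOpen W) : IsC1On W φ := by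
  intro w hw
  obtain ⟨r, hr, hrW⟩ := Metric.isOpen_iff.1 hW w hw
  exact ⟨r, hr, φ, hφ.mono hrW, fun _ _ => rfl⟩

theorem isC1On_of_contDiff {N M : ℕ} {X : Set (Euc N)} {φ : Euc N → Euc M}
    (hφ : ContDiff ℝ 1 φ) : IsC1On X φ := fun _ _ => ⟨1, one_pos, φ, hφ.contDiffOn, fun _ _ => rfl⟩

/-- A function that vanishes on `X` has zero derivative in the directions tangent to `X`. -/
theorem fderiv_eq_zero_of_mem_tangentSpaceAt {N d : ℕ} {X : Set (Euc N)} {x v : Euc N}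
    {T : Euc N → ℝ} {L : Euc N →L[ℝ] ℝ} (hT : ∀ y ∈ X, T y = 0) (hL : HasFDerivAt T L x)
    (hv : v ∈ tangentSpaceAt d X x) : L v = 0 := by
  obtain ⟨W, Y, φ, w, hφ, hw, rfl, a, rfl⟩ := hv
  have h1 := ((hφ.c1.contDiffAt hφ.isOpen_source hw).differentiableAt one_ne_zero).hasFDerivAt
  have h2 := hL.comp w h1
  have h3 : T ∘ φ =ᶠ[𝓝 w] fun _ => 0 := by
    filter_upwards [hφ.isOpen_source.mem_nhds hw] with y hy
    obtain ⟨O, -, hO⟩ := hφ.relOpen_target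
    have := hφ.bijOn.mapsTo hy
    rw [hO] at this
    exact hT _ this.1
  have h4 := h2.unique ((hasFDerivAt_const (0 : ℝ) w).congr_of_eventuallyEq h3)
  exact congrArg (fun A : Euc d →L[ℝ] ℝ => A a) h4

variable {n : ℕ} {G g : Euc n → Euc n} {e x₀ : Euc n} {K B R δ : ℝ} {U : Set (Euc n)}

/-- A level set of the local solution is the graph, over the hyperplane `e^⊥`, of the descent
function, hence a `C¹` hypersurface. -/
theorem isC1Manifold_leafHeight (hn : n ≠ 0) (hG : IsTransversal G e K B)
    (hflat : ∀ᵐ x ∂(volume.restrict (Metric.ball x₀ R)),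
      ∀ a b, curvature e (G x) (fderiv ℝ G x) a b = 0)
    (hδ1 : (1 + 2 * B) * δ ≤ 1) (hδ : (1 + 2 * B) * δ < R / 2) (c : ℝ) :
    IsC1Manifold (n - 1) {x ∈ Metric.ball x₀ δ | leafHeight G e x₀ x = c} := by
  have hB := hG.B_nonneg
  rintro x₁ ⟨hx₁, hc⟩
  rw [Metric.mem_ball, dist_eq_norm] at hx₁
  have hδ0 : 0 < δ := lt_of_le_of_lt (norm_nonneg _) hx₁
  have hδ' : δ ≤ 1 := by nlinarith
  have hcB : |c| ≤ B * δ := by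
    rw [← hc]; exact (abs_leafHeight_le hG).trans (by gcongr)
  have hp : ‖x₀ + c • e - x₀‖ + (1 + B) * δ < R / 2 := by
    rw [add_sub_cancel_left, norm_smul, hG.norm_e, mul_one, Real.norm_eq_abs]
    linarith
  set H : Submodule ℝ (Euc n) := (ℝ ∙ e)ᗮ with hH
  have hrank : Module.finrank ℝ H = n - 1 := by
    have : Fact (Module.finrank ℝ (Euc n) = (n - 1) + 1) := ⟨by simp; omega⟩
    exact Submodule.finrank_orthogonal_span_singleton (by
      intro h0; have := hG.norm_e; rw [h0] at this; simp at this)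
  let ι : H ≃ₗᵢ[ℝ] Euc (n - 1) := ((stdOrthonormalBasis ℝ H).reindex (finCongr hrank)).repr
  have hproj : ∀ y : Euc n, ((H.orthogonalProjectionOnto y : H) : Euc n) = y - ⟪e, y⟫ • e := by
    intro y
    rw [Submodule.coe_orthogonalProjectionOnto_apply, Submodule.starProjection_orthogonal_val,
      Submodule.starProjection_unit_singleton ℝ hG.norm_e]
  let j : Euc (n - 1) → Euc n := fun w => (ι.symm w : Euc n)
  have hjn : ∀ w, ‖j w‖ = ‖w‖ := fun w => by
    simp only [j]; rw [← Submodule.coe_norm, ι.symm.norm_map]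
  have hjd : ContDiff ℝ 1 j :=
    (H.subtypeL.contDiff).comp ι.symm.toContinuousLinearEquiv.contDiff
  let φ : Euc (n - 1) → Euc n := fun w => leafPoint G e (x₀ + c • e) (j w)
  let ψ : Euc n → Euc (n - 1) := fun x => ι (H.orthogonalProjectionOnto (x - x₀))
  have hφd : ContDiffOn ℝ 1 φ (Metric.ball 0 δ) := by
    have h1 : ContDiffOn ℝ 1 (fun w => descent G e (x₀ + c • e) (j w)) (Metric.ball 0 δ) :=
      (contDiffOn_descent hG hflat hδ' hp).comp hjd.contDiffOn
        (fun w hw => by simpa [hjn] using hw)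
    unfold φ leafPoint
    exact (contDiffOn_const.add hjd.contDiffOn).sub (h1.smul contDiffOn_const)
  have hψd : ContDiff ℝ 1 ψ :=
    (ι.toContinuousLinearEquiv.contDiff).comp
      ((H.orthogonalProjectionOnto.contDiff).comp (contDiff_id.sub contDiff_const))
  have hψφ : ∀ w, ψ (φ w) = w := by
    intro w
    have h1 : H.orthogonalProjectionOnto (φ w - x₀) = ι.symm w := by
      have he : H.orthogonalProjectionOnto e = 0 := by
        apply Subtype.ext
        rw [hproj, real_inner_self_eq_norm_sq, hG.norm_e]; simp
      have h2 : φ w - x₀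
          = j w + (c - descent G e (x₀ + c • e) (j w)) • e := by
        simp only [φ, leafPoint]; module
      rw [h2, map_add, map_smul, he, smul_zero, add_zero]
      exact Submodule.orthogonalProjectionOnto_mem_subspace_eq_self _
    simp only [ψ]
    rw [h1, ι.apply_symm_apply]
  let W : Set (Euc (n - 1)) := Metric.ball 0 δ ∩ φ ⁻¹' Metric.ball x₀ δ
  have hW : IsOpen W := hφd.continuousOn.isOpen_inter_preimage Metric.isOpen_ball
    Metric.isOpen_ball
  have hφψ : ∀ x ∈ {x ∈ Metric.ball x₀ δ | leafHeight G e x₀ x = c}, φ (ψ x) = x ∧ ψ x ∈ W := by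
    rintro x ⟨hx, hxc⟩
    have hx' := hx
    rw [Metric.mem_ball, dist_eq_norm] at hx'
    have hj : j (ψ x) = (x - x₀) + (-⟪e, x - x₀⟫) • e := by
      simp only [j, ψ]
      rw [ι.symm_apply_apply, hproj]; module
    have hjx : ‖j (ψ x)‖ ≤ ‖x - x₀‖ := by
      simp only [j, ψ]
      rw [ι.symm_apply_apply, ← Submodule.coe_norm]
      exact H.norm_orthogonalProjectionOnto_apply_le _
    have h1 := (leafHeight_eq_iff (s := c) hG (hx'.le.trans hδ')).1 hxc
    have h2 : descent G e (x₀ + c • e) (x - x₀) = c := by unfold leafGap at h1; linarith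
    have h3 : φ (ψ x) = x := by
      simp only [φ, leafPoint]
      rw [hj] at hjx ⊢
      rw [descent_add_smul hG (hjx.trans (hx'.le.trans hδ')), h2]
      module
    refine ⟨h3, ?_, ?_⟩
    · rw [mem_ball_zero_iff, ← hjn]
      exact hjx.trans_lt hx'
    · rw [mem_preimage, h3]; exact hx
  have hφW : ∀ w ∈ W, φ w ∈ {x ∈ Metric.ball x₀ δ | leafHeight G e x₀ x = c} := by
    rintro w ⟨hw, hφw⟩
    refine ⟨hφw, ?_⟩
    rw [mem_preimage, Metric.mem_ball, dist_eq_norm] at hφw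
    have h2 : φ w = x₀ + j w + (c - descent G e (x₀ + c • e) (j w)) • e := by
      simp only [φ, leafPoint]; module
    rw [leafHeight_eq_iff hG (hφw.le.trans hδ'), h2, leafGap_add_smul hG
      (by rw [← h2]; exact hφw.le.trans hδ')]
    unfold leafGap
    rw [add_sub_cancel_left]
    ring
  refine ⟨W, _, φ, ⟨hW, ⟨univ, isOpen_univ, (inter_univ _).symm⟩, ⟨hφW, ?_, ?_⟩,
    isC1On_of_contDiffOn (hφd.mono inter_subset_left) hW, ψ,
    ⟨fun w _ => hψφ w, fun x hx => (hφψ x hx).1⟩,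
    isC1On_of_contDiff hψd⟩, ⟨by rwa [Metric.mem_ball, dist_eq_norm], hc⟩⟩
  · exact (show Function.LeftInverse ψ φ from hψφ).injective.injOn
  · exact fun x hx => ⟨ψ x, (hφψ x hx).2, (hφψ x hx).1⟩

/-- Near `x₀` a flat transversal Lipschitz field proportional to `g` has a regular solution. -/
theorem isRegularSolution_leafHeight (hn : n ≠ 0) (hG : IsTransversal G e K B)
    (hflat : ∀ᵐ x ∂(volume.restrict (Metric.ball x₀ R)),
      ∀ a b, curvature e (G x) (fderiv ℝ G x) a b = 0)
    (hg : ∀ x ∈ Metric.ball x₀ R, 0 < ⟪g x, e⟫ ∧ g x = ⟪g x, e⟫ • G x)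
    (hgc : ContinuousOn g U) (hg0 : ∀ x ∈ U, g x ≠ 0) (hRU : Metric.ball x₀ R ⊆ U) (hδ0 : 0 < δ)
    (hδ1 : (1 + 2 * B) * δ ≤ 1) (hδ : (1 + 2 * B) * δ < R / 2) :
    IsRegularSolution U g (Metric.ball x₀ δ) (leafHeight G e x₀) := by
  have hB := hG.B_nonneg
  have hK := hG.K_nonneg
  have hδ' : δ ≤ 1 := by nlinarith
  have hδR : δ ≤ R := by nlinarith
  have hball : ∀ {x}, x ∈ Metric.ball x₀ δ → ‖x - x₀‖ < δ := fun hx => by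
    rwa [Metric.mem_ball, dist_eq_norm] at hx
  set u := leafHeight G e x₀ with hu
  have hsub : Metric.ball x₀ δ ⊆ U := (Metric.ball_subset_ball hδR).trans hRU
  have hleaf : ∀ z ∈ Metric.ball x₀ δ, IsLeafFunction g u e z (leafGap G e x₀ (u z)) :=
    fun z hz => isLeafFunction_leafGap hG hflat hg hδ1 hδ (hball hz)
  have hlip : LipschitzOnWith ⟨(2 * K + B) * Real.exp K, by positivity⟩ u (Metric.ball x₀ δ) :=
    LipschitzOnWith.of_dist_le_mul fun x hx y hy => by
      rw [Real.dist_eq, dist_eq_norm]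
      exact abs_leafHeight_sub_le hG ((hball hx).le.trans hδ')
  -- along `e` the solution grows at least linearly
  have hgrow : ∀ x ∈ Metric.ball x₀ δ, ∀ᶠ s in 𝓝 (0 : ℝ),
      (0 < s → u x + s * Real.exp (-K) ≤ u (x + s • e)) ∧ (s < 0 → u (x + s • e) < u x) := by
    intro x hx
    have h1 : Tendsto (fun s : ℝ => x + s • e) (𝓝 0) (𝓝 x) := by
      have : Continuous fun s : ℝ => x + s • e := by fun_prop
      simpa using this.tendsto 0
    filter_upwards [h1.eventually (Metric.isOpen_ball.mem_nhds hx)] with s hs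
    refine ⟨fun h0 => leafHeight_add_le hG ((hball hx).le.trans hδ')
      ((hball hs).le.trans hδ') h0, fun h0 => ?_⟩
    have hxs : x + s • e + (-s) • e = x := by module
    have := leafHeight_add_le (x := x + s • e) (τ := -s) hG ((hball hs).le.trans hδ')
      (by rw [hxs]; exact (hball hx).le.trans hδ') (neg_pos.2 h0)
    rw [hxs] at this
    have := mul_pos (neg_pos.2 h0) (Real.exp_pos (-K))
    change leafHeight G e x₀ (x + s • e) < leafHeight G e x₀ x
    linarith
  have hline : ∀ x : Euc n, Tendsto (fun s : ℝ => x + s • e) (𝓝 0) (𝓝 x) := fun x => by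
    have : Continuous fun s : ℝ => x + s • e := by fun_prop
    simpa using this.tendsto 0
  refine ⟨⟨Metric.isOpen_ball, hsub, fun _ _ => ⟨_, _, self_mem_nhdsWithin, hlip⟩,
    isC1Manifold_leafHeight hn hG hflat hδ1 hδ, ?_, ?_, ?_, ?_⟩,
    ⟨Metric.nonempty_ball.2 hδ0, (convex_ball _ _).isPreconnected⟩, ?_⟩
  · rintro c x ⟨hx, rfl⟩ v hv
    have hs : |u x| ≤ B * δ :=
      (abs_leafHeight_le hG).trans (mul_le_mul_of_nonneg_left (hball hx).le hB)
    have h1 := (hasFDerivAt_leafGap hG hflat hδ' hδ hs (hball hx)).1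
    have h2 := fderiv_eq_zero_of_mem_tangentSpaceAt (fun y hy =>
      (leafHeight_eq_iff hG ((hball hy.1).le.trans hδ')).1 hy.2) h1 hv
    rw [(hleaf x hx).apply_self, zero_smul, sub_zero, innerSL_apply_apply] at h2
    rw [(hg x (Metric.ball_subset_ball hδR hx)).2, real_inner_smul_left, h2, mul_zero]
  · intro x hx hmax
    have h1 := (((hline x).eventually hmax).and (hgrow x hx)).filter_mono
      (nhdsWithin_le_nhds (s := Ioi 0))
    obtain ⟨s, ⟨hs1, hs2⟩, hs3⟩ := (h1.and self_mem_nhdsWithin).exists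
    have := hs2.1 hs3
    have := mul_pos hs3 (Real.exp_pos (-K))
    linarith
  · intro x hx hmin
    have h1 := (((hline x).eventually hmin).and (hgrow x hx)).filter_mono
      (nhdsWithin_le_nhds (s := Iio 0))
    obtain ⟨s, ⟨hs1, hs2⟩, hs3⟩ := (h1.and self_mem_nhdsWithin).exists
    have := hs2.2 hs3
    linarith
  · intro x hx hd h0
    have h1 : HasFDerivAt u (0 : Euc n →L[ℝ] ℝ) x := by
      have := hd.hasGradientAt.hasFDerivAt
      rwa [h0, map_zero] at this
    have h2 : HasDerivAt (fun s : ℝ => x + s • e) e 0 := by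
      simpa using ((hasDerivAt_id (0 : ℝ)).smul_const e).const_add x
    have h3 : HasDerivAt (fun s : ℝ => u (x + s • e)) 0 0 := by
      have h4 : HasFDerivAt u (0 : Euc n →L[ℝ] ℝ) (x + (0 : ℝ) • e) := by simpa using h1
      exact h4.comp_hasDerivAt 0 h2
    have h5 := (hasDerivAt_iff_tendsto_slope.1 h3).eventually_lt_const (Real.exp_pos (-K))
    have h6 : 𝓝[>] (0 : ℝ) ≤ 𝓝[≠] 0 := nhdsWithin_mono _ fun s hs => ne_of_gt hs
    obtain ⟨s, ⟨hs1, hs2⟩, hs3⟩ := ((Eventually.and (h6 h5)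
      ((hgrow x hx).filter_mono nhdsWithin_le_nhds)).and self_mem_nhdsWithin).exists
    have hs4 := hs2.1 hs3
    change slope (fun s : ℝ => u (x + s • e)) 0 s < Real.exp (-K) at hs1
    rw [slope_def_field, zero_smul, add_zero, sub_zero, div_lt_iff₀ hs3] at hs1
    linarith
  · intro x hx
    have hcx : ContinuousAt (fun t : ℝ => x + t • g x) 0 := by fun_prop
    have hx0 : x + (0 : ℝ) • g x = x := by simp
    have hev : ∀ᶠ t in 𝓝 (0 : ℝ), x + t • g x ∈ Metric.ball x₀ δ ∧
        0 < ⟪g (x + t • g x), g x⟫ := by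
      have hgx : ContinuousAt g (x + (0 : ℝ) • g x) := by
        rw [hx0]
        exact (hgc.mono hsub).continuousAt (Metric.isOpen_ball.mem_nhds hx)
      refine (hcx.eventually_mem (Metric.isOpen_ball.mem_nhds (by rwa [hx0]))).and ?_
      have h1 : ContinuousAt (fun t : ℝ => ⟪g (x + t • g x), g x⟫) 0 :=
        (hgx.comp (f := fun t : ℝ => x + t • g x) hcx).inner continuousAt_const
      refine continuousAt_const.eventually_lt h1 ?_
      rw [hx0, real_inner_self_eq_norm_sq]
      have := norm_pos_iff.2 (hg0 x (hsub hx))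
      positivity
    obtain ⟨ε, hε, hεP⟩ := Metric.eventually_nhds_iff_ball.1 hev
    rw [Real.ball_eq_Ioo, zero_sub, zero_add] at hεP
    refine ⟨ε, hε, fun t ht => (hεP t ht).1, fun a ha b hb hab => ?_⟩
    have hsubI : Icc a b ⊆ Ioo (-ε) ε := fun t ht => ⟨ha.1.trans_le ht.1, ht.2.trans_lt hb.2⟩
    refine lt_of_frequently_lt (f := fun t : ℝ => u (x + t • g x)) hab ?_ ?_
    · exact hlip.continuousOn.comp (by fun_prop) fun t ht => (hεP t (hsubI ht)).1
    · intro t ht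
      have hP := hεP t (hsubI (Ico_subset_Icc_self ht))
      exact ((hleaf _ hP.1).eventually_lt_line hP.2).frequently

/-! ### Level sets of a regular solution -/

section LevelSets

variable {n : ℕ} {U V : Set (Euc n)} {g : Euc n → Euc n} {u : Euc n → ℝ} {z : Euc n}

theorem IsNormalSolution.continuousOn (h : IsNormalSolution U g V u) : ContinuousOn u V :=
  h.locallyLipschitz.continuousOn

/-- The differential of a local parametrization is injective. -/
theorem IsLocalParam.injective_fderiv {N d : ℕ} {X Y : Set (Euc N)} {W : Set (Euc d)}
    {φ : Euc d → Euc N} (hφ : IsLocalParam X W Y φ) {w : Euc d} (hw : w ∈ W) :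
    Function.Injective (fderiv ℝ φ w) := by
  obtain ⟨ψ, hinv, hψ⟩ := hφ.c1_inv
  have hφw := hφ.c1.contDiffAt hφ.isOpen_source hw
  obtain ⟨r, hr, F, hF, hFψ⟩ := hψ (φ w) (hφ.bijOn.mapsTo hw)
  have hFd := (hF.contDiffAt (Metric.ball_mem_nhds _ hr)).differentiableAt one_ne_zero
  have h1 := hFd.hasFDerivAt.comp w (hφw.differentiableAt one_ne_zero).hasFDerivAt
  have h2 : F ∘ φ =ᶠ[𝓝 w] id := by
    filter_upwards [hφ.isOpen_source.mem_nhds hw,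
      hφw.continuousAt.eventually_mem (Metric.ball_mem_nhds (φ w) hr)] with y hy1 hy2
    rw [Function.comp_apply, hFψ _ ⟨hφ.bijOn.mapsTo hy1, hy2⟩, hinv.1 hy1, id]
  have h3 := h1.unique ((hasFDerivAt_id w).congr_of_eventuallyEq h2)
  refine Function.LeftInverse.injective (g := fderiv ℝ F (φ w)) fun a => ?_
  exact congrArg (fun A : Euc d →L[ℝ] Euc d => A a) h3

theorem isPreconnected_box {E : Type*} [NormedAddCommGroup E] [NormedSpace ℝ E] (w : E)
    (r a b : ℝ) :
    IsPreconnected (Metric.ball w r ×ˢ Ioo a b) :=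
  ((convex_ball w r).prod (convex_Ioo a b)).isPreconnected

/-- A regular solution has a leaf function at every point. By the inverse function theorem the map
`(w, τ) ↦ φ w + τ g(z)`, where `φ` parametrizes the level set of `z`, provides coordinates near `z`,
and the leaf function is the coordinate `τ`. On each of the two sides of the level set the sign of
`u - u z` is constant, and it is read off on the line through `z` in direction `g(z)`. -/
theorem IsRegularSolution.exists_isLeafFunction (h : IsRegularSolution U g V u) (hz : z ∈ V)
    (hgz : g z ≠ 0) : ∃ T, IsLeafFunction g u (g z) z T := by
  have hn : n ≠ 0 := by
    rintro rfl
    exact hgz (Subsingleton.elim _ _)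
  obtain ⟨W, Y, φ, hφ, hzY⟩ := h.normal.level_manifold (u z) z ⟨hz, rfl⟩
  obtain ⟨w₀, hw₀, hφw₀⟩ := hφ.bijOn.surjOn hzY
  obtain ⟨O, hO, hYO⟩ := hφ.relOpen_target
  obtain ⟨ψ, hinv, hψ⟩ := hφ.c1_inv
  set e := g z with he
  have hpos : 0 < ⟪e, e⟫ := real_inner_self_pos.2 hgz
  have htan : ∀ w ∈ W, ∀ a, ⟪g (φ w), fderiv ℝ φ w a⟫ = 0 := by
    intro w hw a
    have hm := hφ.bijOn.mapsTo hw
    rw [hYO] at hm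
    exact h.normal.level_normal (u z) (φ w) hm.1 _ ⟨W, Y, φ, w, hφ, hw, rfl, a, rfl⟩
  let Φ : Euc (n - 1) × ℝ → Euc n := fun p => φ p.1 + p.2 • e
  have hΦz : Φ (w₀, 0) = z := by simp [Φ, hφw₀]
  have hφd : ∀ w ∈ W, ContDiffAt ℝ 1 φ w := fun w hw => hφ.c1.contDiffAt hφ.isOpen_source hw
  have hΦd : ∀ p : Euc (n - 1) × ℝ, p.1 ∈ W → ContDiffAt ℝ 1 Φ p := fun p hp =>
    ((hφd p.1 hp).comp p contDiffAt_fst).add (contDiffAt_snd.smul contDiffAt_const)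
  let L : Euc (n - 1) × ℝ →L[ℝ] Euc n :=
    (fderiv ℝ φ w₀).comp (ContinuousLinearMap.fst ℝ _ _) +
      (ContinuousLinearMap.snd ℝ _ _).smulRight e
  have hL : HasFDerivAt Φ L (w₀, 0) := by
    have h1 := ((hφd w₀ hw₀).differentiableAt one_ne_zero).hasFDerivAt
    have h2 : HasFDerivAt (fun p : Euc (n - 1) × ℝ => φ p.1)
        ((fderiv ℝ φ w₀).comp (ContinuousLinearMap.fst ℝ _ _)) (w₀, 0) :=
      h1.comp (w₀, (0 : ℝ)) hasFDerivAt_fst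
    exact h2.add (hasFDerivAt_snd.smul_const e)
  have hLinj : Function.Injective L := by
    rw [injective_iff_map_eq_zero]
    rintro ⟨a, τ⟩ hLa
    have h1 : fderiv ℝ φ w₀ a + τ • e = 0 := by simpa [L] using hLa
    have h2 : ⟪e, fderiv ℝ φ w₀ a + τ • e⟫ = 0 := by rw [h1, inner_zero_right]
    have h3 := htan w₀ hw₀ a
    rw [hφw₀, ← he] at h3
    rw [inner_add_right, h3, inner_smul_right, zero_add] at h2
    have hτ : τ = 0 := (mul_eq_zero.1 h2).resolve_right hpos.ne'
    rw [hτ, zero_smul, add_zero] at h1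
    have ha : a = 0 := hφ.injective_fderiv hw₀ (by rw [h1, map_zero])
    rw [ha, hτ]; rfl
  have hfin : Module.finrank ℝ (Euc (n - 1) × ℝ) = Module.finrank ℝ (Euc n) := by
    simp; omega
  let Le : (Euc (n - 1) × ℝ) ≃L[ℝ] Euc n :=
    (LinearMap.linearEquivOfInjective (L : Euc (n - 1) × ℝ →ₗ[ℝ] Euc n) hLinj
      hfin).toContinuousLinearEquiv
  have hLe : HasFDerivAt Φ (Le : Euc (n - 1) × ℝ →L[ℝ] Euc n) (w₀, 0) := by
    have : (Le : Euc (n - 1) × ℝ →L[ℝ] Euc n) = L := 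
      ContinuousLinearMap.ext fun p => rfl
    rwa [this]
  have hΦ0 := hΦd (w₀, 0) hw₀
  have hstrict := hΦ0.hasStrictFDerivAt' hLe one_ne_zero
  set inv := hstrict.localInverse Φ Le (w₀, 0) with hinvdef
  have hinvd : ContDiffAt ℝ 1 inv z := by
    have := hΦ0.to_localInverse hLe one_ne_zero
    rwa [hΦz] at this
  have hright : ∀ᶠ x in 𝓝 z, Φ (inv x) = x := by
    have := hstrict.eventually_right_inverse
    rwa [hΦz] at this
  have hleft : ∀ᶠ p in 𝓝 (w₀, (0 : ℝ)), inv (Φ p) = p := hstrict.eventually_left_inverse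
  have hinvz : inv z = (w₀, 0) := by
    rw [← hΦz]; exact hleft.self_of_nhds
  have hinvt : Tendsto inv (𝓝 z) (𝓝 (w₀, (0 : ℝ))) := by
    have := hinvd.continuousAt.tendsto
    rwa [hinvz] at this
  have hΦt : Tendsto Φ (𝓝 (w₀, (0 : ℝ))) (𝓝 z) := by
    have := hΦ0.continuousAt.tendsto
    rwa [hΦz] at this
  have hVO : ∀ᶠ x in 𝓝 z, x ∈ V ∧ x ∈ O :=
    Eventually.and (h.normal.isOpen.mem_nhds hz) (hO.mem_nhds (by rw [hYO] at hzY; exact hzY.2))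
  -- near `z` the level set consists of the points with second coordinate zero
  have hψY : ∀ᶠ x in 𝓝 z, x ∈ Y → inv x = (ψ x, 0) := by
    obtain ⟨r, hr, F, hF, hFψ⟩ := hψ z hzY
    have hFc : ContinuousAt F z := (hF.contDiffAt (Metric.ball_mem_nhds _ hr)).continuousAt
    have hFz : F z = w₀ := by
      rw [hFψ z ⟨hzY, Metric.mem_ball_self hr⟩, ← hφw₀, hinv.1 hw₀]
    have h1 : Tendsto (fun x => (F x, (0 : ℝ))) (𝓝 z) (𝓝 (w₀, 0)) := by
      have := hFc.tendsto
      rw [hFz] at this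
      exact this.prodMk_nhds tendsto_const_nhds
    filter_upwards [h1.eventually hleft, Metric.ball_mem_nhds z hr] with x hx1 hx2 hxY
    have hFx := hFψ x ⟨hxY, hx2⟩
    have hΦx : Φ (ψ x, 0) = x := by
      simp only [Φ, zero_smul, add_zero]
      exact hinv.2 hxY
    rw [hFx, hΦx] at hx1
    exact hx1
  have hbox : ∀ᶠ p in 𝓝 (w₀, (0 : ℝ)),
      p.1 ∈ W ∧ Φ p ∈ V ∧ (u (Φ p) = u z ↔ p.2 = 0) := by
    have hW : ∀ᶠ p : Euc (n - 1) × ℝ in 𝓝 (w₀, (0 : ℝ)), p.1 ∈ W :=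
      continuousAt_fst.eventually_mem (hφ.isOpen_source.mem_nhds hw₀)
    filter_upwards [hW, hΦt.eventually hVO, hΦt.eventually hψY, hleft] with p hp1 hp2 hp3 hp4
    refine ⟨hp1, hp2.1, fun hu => ?_, fun h0 => ?_⟩
    · have hY : Φ p ∈ Y := by rw [hYO]; exact ⟨⟨hp2.1, hu⟩, hp2.2⟩
      have := hp3 hY
      rw [hp4] at this
      rw [this]
    · have : Φ p = φ p.1 := by simp [Φ, h0]
      rw [this]
      have hm := hφ.bijOn.mapsTo hp1
      rw [hYO] at hm
      exact hm.1.2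
  obtain ⟨r, hr, hrP⟩ := Metric.eventually_nhds_iff_ball.1 hbox
  rw [← ball_prod_same, Real.ball_eq_Ioo, zero_sub, zero_add] at hrP
  obtain ⟨ε, hε, -, hmono⟩ := h.increasing z hz
  set t₀ := min r ε / 2 with ht₀
  have ht₀pos : 0 < t₀ := by positivity
  have ht₀r : t₀ < r := by have := min_le_left r ε; rw [ht₀]; linarith
  have ht₀ε : t₀ < ε := by have := min_le_right r ε; rw [ht₀]; linarith
  have hcont : ContinuousOn (fun p => u (Φ p)) (Metric.ball w₀ r ×ˢ Ioo (-r) r) := by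
    refine h.normal.continuousOn.comp (fun p hp => ?_) fun p hp => (hrP p hp).2.1
    exact (hΦd p (hrP p hp).1).continuousAt.continuousWithinAt
  have hΦw : ∀ t : ℝ, Φ (w₀, t) = z + t • e := fun t => by simp [Φ, hφw₀]
  have hup : ∀ p ∈ Metric.ball w₀ r ×ˢ Ioo 0 r, u z < u (Φ p) := by
    intro p hp
    by_contra hle
    have hsub : Metric.ball w₀ r ×ˢ Ioo 0 r ⊆ Metric.ball w₀ r ×ˢ Ioo (-r) r :=
      prod_mono_right (Ioo_subset_Ioo_left (by linarith))
    have h1 : u z < u (Φ (w₀, t₀)) := by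
      rw [hΦw]
      have := hmono ⟨by linarith, hε⟩ ⟨by linarith, ht₀ε⟩ ht₀pos
      simpa using this
    obtain ⟨q, hq, hqz⟩ := (isPreconnected_box w₀ r 0 r).intermediate_value hp
      (show (w₀, t₀) ∈ Metric.ball w₀ r ×ˢ Ioo 0 r from
        ⟨Metric.mem_ball_self hr, ht₀pos, ht₀r⟩) (hcont.mono hsub) ⟨not_lt.1 hle, h1.le⟩
    exact hq.2.1.ne' ((hrP q (hsub hq)).2.2.1 hqz)
  have hdown : ∀ p ∈ Metric.ball w₀ r ×ˢ Ioo (-r) 0, u (Φ p) < u z := by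
    intro p hp
    by_contra hle
    have hsub : Metric.ball w₀ r ×ˢ Ioo (-r) 0 ⊆ Metric.ball w₀ r ×ˢ Ioo (-r) r :=
      prod_mono_right (Ioo_subset_Ioo_right hr.le)
    have h1 : u (Φ (w₀, -t₀)) < u z := by
      rw [hΦw]
      have := hmono ⟨by linarith, by linarith⟩ ⟨by linarith, hε⟩ (neg_neg_of_pos ht₀pos)
      simpa using this
    obtain ⟨q, hq, hqz⟩ := (isPreconnected_box w₀ r (-r) 0).intermediate_value
      (show (w₀, -t₀) ∈ Metric.ball w₀ r ×ˢ Ioo (-r) 0 from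
        ⟨Metric.mem_ball_self hr, by linarith, by linarith⟩) hp (hcont.mono hsub)
      ⟨h1.le, not_lt.1 hle⟩
    exact hq.2.2.ne ((hrP q (hsub hq)).2.2.1 hqz)
  have hinbox : ∀ᶠ x in 𝓝 z, inv x ∈ Metric.ball w₀ r ×ˢ Ioo (-r) r :=
    hinvt.eventually_mem (prod_mem_nhds (Metric.ball_mem_nhds _ hr)
      (Ioo_mem_nhds (by linarith) hr))
  have hsign : ∀ᶠ x in 𝓝 z, (0 < (inv x).2 → u z < u x) ∧ ((inv x).2 < 0 → u x < u z) ∧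
      ((inv x).2 = 0 → u x = u z) := by
    filter_upwards [hright, hinbox] with x hx1 hx2
    refine ⟨fun hs => ?_, fun hs => ?_, fun hs => ?_⟩
    · rw [← hx1]; exact hup _ ⟨hx2.1, hs, hx2.2.2⟩
    · rw [← hx1]; exact hdown _ ⟨hx2.1, hx2.2.1, hs⟩
    · rw [← hx1]; exact (hrP _ hx2).2.2.2 hs
  have hinvdd : ∀ᶠ x in 𝓝 z, ContDiffAt ℝ 1 inv x := hinvd.eventually (by simp)
  refine ⟨fun x => (inv x).2, hpos, ?_, ?_, ?_, ?_⟩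
  · filter_upwards [hinvdd] with x hx using contDiffAt_snd.comp x hx
  · filter_upwards [hsign] with x hx
    refine ⟨hx.1, fun hu => ?_⟩
    rcases lt_trichotomy (inv x).2 0 with h0 | h0 | h0
    · linarith [hx.2.1 h0]
    · linarith [hx.2.2 h0]
    · exact h0
  · filter_upwards [hsign] with x hx
    refine ⟨hx.2.1, fun hu => ?_⟩
    rcases lt_trichotomy (inv x).2 0 with h0 | h0 | h0
    · exact h0
    · linarith [hx.2.2 h0]
    · linarith [hx.1 h0]
  · -- `x - T x • e = φ (inv x).1` moves within the level set
    filter_upwards [hinvdd, hright.eventually_nhds, hinbox] with x hx1 hx2 hx3 a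
    have hfoot : (fun y => y - (inv y).2 • e) =ᶠ[𝓝 x] fun y => φ (inv y).1 := by
      filter_upwards [hx2] with y hy
      have : φ (inv y).1 + (inv y).2 • e = y := hy
      rw [sub_eq_iff_eq_add]
      exact this.symm
    have hw := (hrP _ hx3).1
    have hTd : DifferentiableAt ℝ (fun y => (inv y).2) x :=
      (contDiffAt_snd.comp x hx1).differentiableAt one_ne_zero
    have hwd : DifferentiableAt ℝ (fun y => (inv y).1) x :=
      (contDiffAt_fst.comp x hx1).differentiableAt one_ne_zero
    have h1 : HasFDerivAt (fun y => y - (inv y).2 • e)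
        (ContinuousLinearMap.id ℝ (Euc n) - (fderiv ℝ (fun y => (inv y).2) x).smulRight e) x :=
      (hasFDerivAt_id x).sub (hTd.hasFDerivAt.smul_const e)
    have h2 : HasFDerivAt (fun y => φ (inv y).1)
        ((fderiv ℝ φ (inv x).1).comp (fderiv ℝ (fun y => (inv y).1) x)) x :=
      (((hφd _ hw).differentiableAt one_ne_zero).hasFDerivAt).comp x hwd.hasFDerivAt
    have h3 := congrArg (fun A : Euc n →L[ℝ] Euc n => A a)
      (h1.unique (h2.congr_of_eventuallyEq hfoot))
    have h4 : a - fderiv ℝ (fun y => (inv y).2) x a • e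
        = fderiv ℝ φ (inv x).1 (fderiv ℝ (fun y => (inv y).1) x a) := by simpa using h3
    rw [h4, show x - (inv x).2 • e = φ (inv x).1 from hfoot.self_of_nhds]
    exact htan _ hw _

end LevelSets

/-! ### Strict quasi-convexity -/

section QuasiConvexity

variable {n : ℕ} {U V : Set (Euc n)} {g : Euc n → Euc n} {u : Euc n → ℝ} {z v : Euc n}

/-- If strict quasi-convexity fails, `u` has a maximum along a line segment at an interior point of
that segment. -/
theorem exists_max_of_not_strictQuasiConvexOn (hV : Convex ℝ V) (hu : ContinuousOn u V)
    (h : ¬ StrictQuasiConvexOn V u) :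
    ∃ z ∈ V, ∃ v : Euc n, v ≠ 0 ∧ ∀ᶠ s in 𝓝 (0 : ℝ), u (z + s • v) ≤ u z := by
  unfold StrictQuasiConvexOn at h
  push Not at h
  obtain ⟨x, hx, y, hy, hxy, t, ht, hle⟩ := h
  have hmem : ∀ s ∈ Icc (0 : ℝ) 1, x + s • (y - x) ∈ V := fun s hs =>
    hV.add_smul_sub_mem hx hy hs
  have hc : ContinuousOn (fun s : ℝ => u (x + s • (y - x))) (Icc 0 1) :=
    hu.comp (by fun_prop) hmem
  obtain ⟨a, ha, hmax⟩ := isCompact_Icc.exists_isMaxOn (nonempty_Icc.2 zero_le_one) hc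
  rw [show (1 - t) • x + t • y = x + t • (y - x) by module] at hle
  obtain ⟨b, hb, hbmax⟩ : ∃ b ∈ Ioo (0 : ℝ) 1, ∀ s ∈ Icc (0 : ℝ) 1,
      u (x + s • (y - x)) ≤ u (x + b • (y - x)) := by
    by_cases ha' : a ∈ Ioo (0 : ℝ) 1
    · exact ⟨a, ha', fun s hs => hmax hs⟩
    · refine ⟨t, ht, fun s hs => le_trans (hmax hs) (le_trans ?_ hle)⟩
      have h01 : a = 0 ∨ a = 1 := by
        by_contra hne
        push Not at hne
        exact ha' ⟨lt_of_le_of_ne ha.1 (Ne.symm hne.1), lt_of_le_of_ne ha.2 hne.2⟩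
      rcases h01 with rfl | rfl
      · simp
      · simp
  refine ⟨x + b • (y - x), hmem b (Ioo_subset_Icc_self hb), y - x,
    sub_ne_zero.2 (Ne.symm hxy), ?_⟩
  have hcb : ContinuousAt (fun s : ℝ => b + s) 0 := by fun_prop
  filter_upwards [hcb.eventually_mem (Icc_mem_nhds (by simpa using hb.1) (by simpa using hb.2))]
    with s hs
  rw [show x + b • (y - x) + s • (y - x) = x + (b + s) • (y - x) by module]
  exact hbmax _ hs

/-- At an interior maximum along a line the field `g` is orthogonal to the line. -/
theorem IsLeafFunction.inner_eq_zero_of_max {e : Euc n} {T : Euc n → ℝ}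
    (hT : IsLeafFunction g u e z T) (hmax : ∀ᶠ s in 𝓝 (0 : ℝ), u (z + s • v) ≤ u z) :
    ⟪g z, v⟫ = 0 := by
  rcases lt_trichotomy ⟪g z, v⟫ 0 with h | h | h
  · exfalso
    have h1 := hT.eventually_lt (v := -v) (by rw [inner_neg_right]; linarith)
    have h2 : Tendsto (fun s : ℝ => -s) (𝓝[>] 0) (𝓝 0) := by
      have := (continuous_neg (G := ℝ)).tendsto 0
      rw [neg_zero] at this
      exact this.mono_left nhdsWithin_le_nhds
    obtain ⟨s, hs1, hs2⟩ := (h1.and (h2.eventually hmax)).exists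
    rw [smul_neg] at hs1
    rw [neg_smul] at hs2
    linarith
  · exact h
  · exfalso
    obtain ⟨s, hs1, hs2⟩ :=
      ((hT.eventually_lt h).and (hmax.filter_mono nhdsWithin_le_nhds)).exists
    linarith

theorem strictQuasiConvex_of_strictLocalCondition (hg0 : ∀ x ∈ U, g x ≠ 0)
    (hI : StrictLocalCondition U g) : RegularSolutionsStrictlyQuasiConvex U g := by
  intro V u hV hu
  by_contra hcon
  obtain ⟨z, hz, v, hv, hmax⟩ :=
    exists_max_of_not_strictQuasiConvexOn hV hu.normal.continuousOn hcon
  have hleaf : ∀ x ∈ V, ∃ T, IsLeafFunction g u (g x) x T := fun x hx =>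
    hu.exists_isLeafFunction hx (hg0 x (hu.normal.subset hx))
  obtain ⟨T, hT⟩ := hleaf z hz
  have h0 := hT.inner_eq_zero_of_max hmax
  obtain ⟨V', hV', -, hzV', hloc⟩ := hI z (hu.normal.subset hz)
  have hcz : ContinuousAt (fun s : ℝ => z + s • v) 0 := by fun_prop
  have hz0 : z + (0 : ℝ) • v = z := by simp
  have hev : ∀ᶠ s in 𝓝 (0 : ℝ), z + s • v ∈ V ∧ z + s • v ∈ V' ∧ u (z + s • v) ≤ u z :=
    (hcz.eventually_mem (hu.normal.isOpen.mem_nhds (by rwa [hz0]))).and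
      ((hcz.eventually_mem (hV'.mem_nhds (by rwa [hz0]))).and hmax)
  obtain ⟨r, hr, hrP⟩ := Metric.eventually_nhds_iff_ball.1 hev
  rw [Real.ball_eq_Ioo, zero_sub, zero_add] at hrP
  have hpos : ∀ s ∈ Ioo 0 r, 0 < ⟪g (z + s • v), v⟫ := by
    intro s hs
    have hP := hrP s ⟨by linarith [hs.1], hs.2⟩
    have h1 := hloc z hzV' (z + s • v) hP.2.1
      (fun h => hv ((smul_eq_zero.1 (left_eq_add.1 h)).resolve_left hs.1.ne'))
      (by rw [inner_add_right, inner_smul_right, h0]; simp)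
    rw [inner_add_right, inner_smul_right] at h1
    exact (pos_iff_pos_of_mul_pos (by linarith : 0 < s * ⟪g (z + s • v), v⟫)).1 hs.1
  have hlt : ∀ a b, 0 < a → a < b → b < r → u (z + a • v) < u (z + b • v) := by
    intro a b ha hab hb
    have hsub : ∀ t ∈ Icc a b, t ∈ Ioo 0 r := fun t ht =>
      ⟨ha.trans_le ht.1, ht.2.trans_lt hb⟩
    refine lt_of_frequently_lt (f := fun t : ℝ => u (z + t • v)) hab ?_ ?_
    · exact hu.normal.continuousOn.comp (by fun_prop) fun t ht =>
        (hrP t ⟨by linarith [(hsub t ht).1], (hsub t ht).2⟩).1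
    · intro t ht
      have ht' := hsub t (Ico_subset_Icc_self ht)
      obtain ⟨T', hT'⟩ := hleaf _ (hrP t ⟨by linarith [ht'.1], ht'.2⟩).1
      exact (hT'.eventually_lt_line (hpos t ht')).frequently
  have hlim : u z ≤ u (z + (r / 3) • v) := by
    have hcu : ContinuousAt (fun s : ℝ => u (z + s • v)) 0 := by
      have h1 : ContinuousAt u (z + (0 : ℝ) • v) := by
        rw [hz0]
        exact hu.normal.continuousOn.continuousAt (hu.normal.isOpen.mem_nhds hz)
      exact h1.comp (f := fun s : ℝ => z + s • v) hcz
    have h2 : Tendsto (fun s : ℝ => u (z + s • v)) (𝓝[>] 0) (𝓝 (u z)) := by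
      have := hcu.tendsto.mono_left (nhdsWithin_le_nhds (s := Ioi 0))
      rwa [hz0] at this
    refine le_of_tendsto h2 ?_
    filter_upwards [Ioo_mem_nhdsGT (show (0 : ℝ) < r / 3 by positivity)] with s hs
    exact (hlt s (r / 3) hs.1 hs.2 (by linarith)).le
  have h3 := hlt (r / 3) (r / 2) (by positivity) (by linarith) (by linarith)
  have h4 := (hrP (r / 2) ⟨by linarith, by linarith⟩).2.2
  linarith

/-- Under the limsup condition the slope of the level curves in a plane is strictly monotone,
because one of its Dini derivatives has a sign. Hence a level curve through a point at which `u` restricted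
to the tangent line has a maximum would lie strictly on the wrong side of that line. -/
theorem strictQuasiConvex_of_strictLimsupCondition (hU : IsOpen U) (hg0 : ∀ x ∈ U, g x ≠ 0)
    (hgL : LocallyLipschitzOn U g) (hII : StrictLimsupCondition U g) :
    RegularSolutionsStrictlyQuasiConvex U g := by
  intro V u hV hu
  by_contra hcon
  obtain ⟨z, hz, v, hv, hmax⟩ :=
    exists_max_of_not_strictQuasiConvexOn hV hu.normal.continuousOn hcon
  have hzU := hu.normal.subset hz
  obtain ⟨T, hT⟩ := hu.exists_isLeafFunction hz (hg0 z hzU)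
  set e := g z with he
  have h0 : ⟪e, v⟫ = 0 := hT.inner_eq_zero_of_max hmax
  have hgc : ∀ x ∈ U, ContinuousAt g x := fun x hx =>
    hgL.continuousOn.continuousAt (hU.mem_nhds hx)
  have hTz := hT.apply_self
  -- the foot point map onto the level set of `z`
  have hfoot : ContinuousAt (fun x => x - T x • e) z :=
    continuousAt_id.sub (hT.contDiffAt.self_of_nhds.continuousAt.smul continuousAt_const)
  have hfz : z - T z • e = z := by rw [hTz]; simp
  have hgfoot : ContinuousAt (fun x => ⟪g (x - T x • e), e⟫) z := by
    have h1 : ContinuousAt g (z - T z • e) := by rw [hfz]; exact hgc z hzU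
    exact (h1.comp (f := fun x => x - T x • e) hfoot).inner continuousAt_const
  have hev : ∀ᶠ x in 𝓝 z, ContDiffAt ℝ 1 T x ∧ (0 < T x ↔ u z < u x) ∧
      (∀ h, ⟪g (x - T x • e), h - fderiv ℝ T x h • e⟫ = 0) ∧ x - T x • e ∈ U ∧
      0 < ⟪g (x - T x • e), e⟫ := by
    filter_upwards [hT.contDiffAt, hT.pos_iff, hT.orthogonal,
      hfoot.eventually_mem (hU.mem_nhds (by rwa [hfz])),
      continuousAt_const.eventually_lt hgfoot (by rw [hfz]; exact hT.inner_pos)]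
      with x h1 h2 h3 h4 h5 using ⟨h1, h2, h3, h4, h5⟩
  have hcz : Tendsto (fun s : ℝ => z + s • v) (𝓝 0) (𝓝 z) := by
    have : Continuous fun s : ℝ => z + s • v := by fun_prop
    simpa using this.tendsto 0
  obtain ⟨r, hr, hrP⟩ := Metric.eventually_nhds_iff_ball.1 ((hcz.eventually hev).and hmax)
  rw [Real.ball_eq_Ioo, zero_sub, zero_add] at hrP
  set τ : ℝ → ℝ := fun t => T (z + t • v) with hτ
  set m : ℝ → ℝ := fun t => fderiv ℝ T (z + t • v) v with hm
  have hline : ∀ t : ℝ, HasDerivAt (fun s : ℝ => z + s • v) v t := fun t => by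
    simpa using ((hasDerivAt_id t).smul_const v).const_add z
  have hτd : ∀ t ∈ Ioo (-r) r, HasDerivAt τ (m t) t := fun t ht =>
    ((hrP t ht).1.1.differentiableAt one_ne_zero).hasFDerivAt.comp_hasDerivAt t (hline t)
  have hmc : ∀ t ∈ Ioo (-r) r, ContinuousAt m t := by
    intro t ht
    have h1 : ContinuousAt (fderiv ℝ T) (z + t • v) :=
      ((hrP t ht).1.1.fderiv_right (m := 0) (by simp)).continuousAt
    have h2 : ContinuousAt (fun s : ℝ => fderiv ℝ T (z + s • v)) t :=
      ContinuousAt.comp (f := fun s : ℝ => z + s • v) h1 (hline t).continuousAt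
    exact h2.clm_apply continuousAt_const
  have hm0 : m 0 = 0 := by
    have h1 := (hrP 0 ⟨by linarith, hr⟩).1.2.2.1 v
    rw [show z + (0 : ℝ) • v = z by simp, hfz, ← he, inner_sub_right, inner_smul_right, h0,
      zero_sub, neg_eq_zero] at h1
    simpa [hm] using (mul_eq_zero.1 h1).resolve_right hT.inner_pos.ne'
  have hfreq : ∀ t ∈ Ico 0 r, ∃ᶠ s in 𝓝[>] t, m t < m s := by
    intro t ht
    have htr : t ∈ Ioo (-r) r := ⟨by linarith [ht.1], ht.2⟩
    obtain ⟨-, -, horth, hpU, -⟩ := (hrP t htr).1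
    set p := z + t • v - T (z + t • v) • e with hp
    set w := v - m t • e with hw
    have hgw : ⟪g p, w⟫ = 0 := horth v
    have hw0 : w ≠ 0 := by
      intro hw0
      have h1 : ⟪v, w⟫ = 0 := by rw [hw0, inner_zero_right]
      rw [hw, inner_sub_right, inner_smul_right, real_inner_comm e v, h0, mul_zero, sub_zero] at h1
      exact hv (inner_self_eq_zero.1 h1)
    obtain ⟨d, hd0, hd⟩ := EReal.lt_iff_exists_real_btwn.1 (hII p hpU w hgw hw0)
    have hdpos : 0 < d := by exact_mod_cast hd0
    have hfr := frequently_lt_of_lt_limsup (by isBoundedDefault) hd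
    -- the level curve leaves its tangent line by `o(s)`, where `g` changes by `o(s)` only
    obtain ⟨C, Q, hQ, hCQ⟩ := hgL hpU
    rw [hU.nhdsWithin_eq hpU] at hQ
    have hoff : ∀ᶠ s in 𝓝 (0 : ℝ),
        |τ (t + s) - τ t - s * m t| ≤ d / (2 * (C * ‖e‖ * ‖w‖ + 1)) * |s| := by
      have h1 := hasDerivAt_iff_isLittleO_nhds_zero.1 (hτd t htr)
      have h2 := h1.bound (show 0 < d / (2 * (C * ‖e‖ * ‖w‖ + 1)) by positivity)
      simpa using h2
    have hmap : Tendsto (fun s : ℝ => t + s) (𝓝[>] 0) (𝓝[>] t) := by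
      refine tendsto_nhdsWithin_of_tendsto_nhds_of_eventually_within _ ?_ ?_
      · have : Continuous fun s : ℝ => t + s := by fun_prop
        have := this.tendsto 0
        rw [add_zero] at this
        exact this.mono_left nhdsWithin_le_nhds
      · filter_upwards [self_mem_nhdsWithin] with s hs using lt_add_of_pos_right t (mem_Ioi.1 hs)
    refine hmap.frequently ?_
    have htan : Tendsto (fun s : ℝ => p + s • w) (𝓝[>] 0) (𝓝 p) := tendsto_add_smul_nhdsGT p w
    have hcurve : Tendsto (fun s : ℝ => z + (t + s) • v - τ (t + s) • e) (𝓝[>] 0) (𝓝 p) := by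
      have h1 : ContinuousAt (fun a : ℝ => z + a • v - τ a • e) t :=
        (hline t).continuousAt.sub ((hτd t htr).continuousAt.smul continuousAt_const)
      exact h1.tendsto.comp (hmap.mono_right nhdsWithin_le_nhds)
    have hIoo : ∀ᶠ s in 𝓝[>] (0 : ℝ), t + s ∈ Ioo (-r) r :=
      (hmap.mono_right nhdsWithin_le_nhds).eventually (Ioo_mem_nhds htr.1 htr.2)
    refine (hfr.and_eventually ((htan.eventually hQ).and ((hcurve.eventually hQ).and
      ((hoff.filter_mono nhdsWithin_le_nhds).and (hIoo.and self_mem_nhdsWithin))))).mono ?_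
    rintro s ⟨hs1, hs2, hs3, hs4, hs5, hs6⟩
    have hs6' : 0 < s := hs6
    set q := z + (t + s) • v - τ (t + s) • e with hq
    obtain ⟨-, -, horth', -, hpos'⟩ := (hrP (t + s) hs5).1
    have h1 : d * s < ⟪w, g (p + s • w)⟫ := by
      have : d < 1 / s * ⟪w, g (p + s • w)⟫ := by exact_mod_cast hs1
      rw [one_div, inv_mul_eq_div, lt_div_iff₀ hs6'] at this
      exact this
    have h2 : ‖g q - g (p + s • w)‖ ≤ C * (‖e‖ * (d / (2 * (C * ‖e‖ * ‖w‖ + 1)) * s)) := by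
      have h3 := hCQ.dist_le_mul q hs3 (p + s • w) hs2
      rw [dist_eq_norm, dist_eq_norm] at h3
      refine h3.trans (mul_le_mul_of_nonneg_left ?_ C.2)
      rw [show q - (p + s • w) = -((τ (t + s) - τ t - s * m t) • e) by
        simp only [hq, hp, hw, hτ]; module, norm_neg, norm_smul, mul_comm, Real.norm_eq_abs]
      rw [abs_of_pos hs6'] at hs4
      gcongr
    have h3 : |⟪w, g q - g (p + s • w)⟫| ≤ d * s / 2 := by
      refine (abs_real_inner_le_norm _ _).trans ?_
      refine (mul_le_mul_of_nonneg_left h2 (norm_nonneg w)).trans ?_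
      set k := (C : ℝ) * ‖e‖ * ‖w‖ with hk
      have hk0 : 0 ≤ k := by positivity
      calc ‖w‖ * (C * (‖e‖ * (d / (2 * (k + 1)) * s))) = d * s / 2 * (k / (k + 1)) := by
            rw [hk]; field_simp
        _ ≤ d * s / 2 * 1 := by
            gcongr
            rw [div_le_one (by positivity)]; linarith
        _ = d * s / 2 := mul_one _
    have h4 : 0 < ⟪w, g q⟫ := by
      rw [inner_sub_right] at h3
      have := mul_pos hdpos hs6'
      have := (abs_le.1 h3).1
      linarith
    have h5 : ⟪g q, v - m (t + s) • e⟫ = 0 := horth' v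
    have h6 : ⟪w, g q⟫ = (m (t + s) - m t) * ⟪g q, e⟫ := by
      rw [inner_sub_right, inner_smul_right] at h5
      rw [real_inner_comm, hw, inner_sub_right, inner_smul_right]
      linarith
    rw [h6] at h4
    exact sub_pos.1 ((pos_iff_pos_of_mul_pos h4).2 hpos')
  have hmpos : ∀ t ∈ Ioo 0 r, 0 < m t := by
    intro t ht
    rw [← hm0]
    refine lt_of_frequently_lt ht.1 (fun s hs => ?_) fun s hs => hfreq s ⟨hs.1, hs.2.trans ht.2⟩
    exact (hmc s ⟨by linarith [hs.1], hs.2.trans_lt ht.2⟩).continuousWithinAt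
  have hr2 : r / 2 ∈ Ioo (-r) r := ⟨by linarith, by linarith⟩
  obtain ⟨c, hc, hcm⟩ := exists_hasDerivAt_eq_slope τ m (show (0 : ℝ) < r / 2 by positivity)
    (fun t ht => (hτd t ⟨by linarith [ht.1], by linarith [ht.2]⟩).continuousAt.continuousWithinAt)
    (fun t ht => hτd t ⟨by linarith [ht.1], by linarith [ht.2]⟩)
  have h1 := hmpos c ⟨hc.1, by linarith [hc.2]⟩
  have hτ0 : τ 0 = 0 := by simp [hτ, hTz]
  rw [hcm, hτ0, sub_zero, sub_zero] at h1
  have h2 : 0 < τ (r / 2) := (div_pos_iff_of_pos_right (by positivity)).1 h1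
  have h3 := (hrP _ hr2).1.2.1.1 h2
  have h4 := (hrP _ hr2).2
  linarith

/-- A regular solution that is strictly quasi-convex yields the strict monotonicity of `g`: the
half-space in which `⟪g x, y - x⟫ ≥ 0` meets the sublevel set of `x` in `x` only. -/
theorem inner_lt_of_strictQuasiConvexOn (hg0 : ∀ x ∈ U, g x ≠ 0) (hV : Convex ℝ V)
    (hu : IsRegularSolution U g V u)
    (hq : StrictQuasiConvexOn V u) {x y : Euc n} (hx : x ∈ V) (hy : y ∈ V) (hxy : x ≠ y)
    (h : ⟪g x, y⟫ ≥ ⟪g x, x⟫) : ⟪g y, x⟫ < ⟪g y, y⟫ := by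
  have hstrict : ∀ a ∈ V, ∀ b ∈ V, 0 < ⟪g a, b - a⟫ → u a < u b := by
    intro a ha b hb hab
    by_contra hle
    obtain ⟨T, hT⟩ := hu.exists_isLeafFunction ha (hg0 a (hu.normal.subset ha))
    obtain ⟨s, hs1, hs2⟩ :=
      ((hT.eventually_lt hab).and (Ioo_mem_nhdsGT (zero_lt_one (α := ℝ)))).exists
    have hne : a ≠ b := by rintro rfl; simp at hab
    have h1 := hq a ha b hb hne s hs2
    rw [max_eq_left (not_lt.1 hle), show (1 - s) • a + s • b = a + s • (b - a) by module] at h1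
    linarith
  have hweak : ∀ a ∈ V, ∀ b ∈ V, a ≠ b → 0 ≤ ⟪g a, b - a⟫ → u a < u b := by
    intro a ha b hb hne hab
    by_contra hle
    -- push the midpoint a little in the direction `g a`
    have h1 := hq a ha b hb hne (1 / 2) ⟨by norm_num, by norm_num⟩
    rw [max_eq_left (not_lt.1 hle)] at h1
    set c := (1 - (1 / 2 : ℝ)) • a + (1 / 2 : ℝ) • b with hc
    have hcV : c ∈ V := hV ha hb (by norm_num) (by norm_num) (by norm_num)
    have hlim := tendsto_add_smul_nhdsGT c (g a)
    have hnhds : ∀ᶠ x in 𝓝 c, x ∈ V ∧ u x < u a :=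
      Eventually.and (hu.normal.isOpen.mem_nhds hcV)
        ((hu.normal.continuousOn.continuousAt (hu.normal.isOpen.mem_nhds hcV)).eventually_lt
          continuousAt_const h1)
    obtain ⟨s, hs1, hs2⟩ := ((hlim.eventually hnhds).and self_mem_nhdsWithin).exists
    refine absurd (hstrict a ha _ hs1.1 ?_) (not_lt.2 hs1.2.le)
    rw [hc, show (1 - (1 / 2 : ℝ)) • a + (1 / 2 : ℝ) • b + s • g a - a
      = (1 / 2 : ℝ) • (b - a) + s • g a by module, inner_add_right, inner_smul_right,
      inner_smul_right]
    have := mul_pos (mem_Ioi.1 hs2) (real_inner_self_pos.2 (hg0 a (hu.normal.subset ha)))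
    linarith
  by_contra hle
  have h1 := hweak x hx y hy hxy (by rw [inner_sub_right]; linarith)
  have h2 := hweak y hy x hx hxy.symm (by rw [inner_sub_right]; linarith)
  linarith

end QuasiConvexity

/-! ### From Jacobi's condition to a flat transversal field -/

/-- The curvature of the normalised field `c / ⟪c, e⟫` in terms of the derivative `D` of `c`:
it vanishes if the three-form `g ∧ dg` does. -/
theorem curvature_normalize_eq_zero {E : Type*} [NormedAddCommGroup E] [InnerProductSpace ℝ E]
    {c e : E} {D D' : E →L[ℝ] E} (hN : ⟪c, e⟫ ≠ 0)
    (hD' : ∀ v, D' v = ⟪c, e⟫⁻¹ • D v - ((⟪c, e⟫ ^ 2)⁻¹ * ⟪D v, e⟫) • c)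
    (hJ : ∀ a b d, ⟪c, a⟫ * (⟪D b, d⟫ - ⟪D d, b⟫) + ⟪c, b⟫ * (⟪D d, a⟫ - ⟪D a, d⟫)
      + ⟪c, d⟫ * (⟪D a, b⟫ - ⟪D b, a⟫) = 0) (a b : E) :
    curvature e (⟪c, e⟫⁻¹ • c) D' a b = 0 := by
  unfold curvature
  simp only [real_inner_smul_left]
  set N := ⟪c, e⟫ with hNdef
  set X := a - (N⁻¹ * ⟪c, a⟫) • e with hX
  set Y := b - (N⁻¹ * ⟪c, b⟫) • e with hY
  have hcX : ⟪c, X⟫ = 0 := by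
    rw [hX, inner_sub_right, inner_smul_right, ← hNdef]; field_simp; ring
  have hcY : ⟪c, Y⟫ = 0 := by
    rw [hY, inner_sub_right, inner_smul_right, ← hNdef]; field_simp; ring
  have h1 := hJ X Y e
  rw [hcX, hcY, zero_mul, zero_mul, zero_add, zero_add, ← hNdef] at h1
  have h2 := (mul_eq_zero.1 h1).resolve_left hN
  have h3 : ∀ v : E, ⟪D' v, b⟫ = N⁻¹ * ⟪D v, Y⟫ := by
    intro v
    rw [hD', hY, inner_sub_left, inner_sub_right, inner_smul_right, real_inner_smul_left,
      real_inner_smul_left]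
    field_simp
  have h4 : ∀ v : E, ⟪D' v, a⟫ = N⁻¹ * ⟪D v, X⟫ := by
    intro v
    rw [hD', hX, inner_sub_left, inner_sub_right, inner_smul_right, real_inner_smul_left,
      real_inner_smul_left]
    field_simp
  rw [h3, h4, ← mul_sub, h2, mul_zero]

variable {n : ℕ} {U : Set (Euc n)} {g : Euc n → Euc n} {x₀ : Euc n}

theorem eq_zero_of_isLinearMap {f : Euc n → ℝ} (hf : IsLinearMap ℝ f)
    (h : ∀ i, f (EuclideanSpace.single i 1) = 0) (x : Euc n) : f x = 0 := by
  have h1 : hf.mk' f = 0 := by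
    refine (EuclideanSpace.basisFun (Fin n) ℝ).toBasis.ext fun i => ?_
    simpa using h i
  exact congrArg (fun L : Euc n →ₗ[ℝ] ℝ => L x) h1

/-- Jacobi's condition on the coordinates is the vanishing of a trilinear form. -/
theorem trilinear_of_jacobi {c : Euc n} {D : Euc n →L[ℝ] Euc n}
    (h : ∀ i j k : Fin n,
      c i * (D (EuclideanSpace.single k 1) j - D (EuclideanSpace.single j 1) k)
        + c j * (D (EuclideanSpace.single i 1) k - D (EuclideanSpace.single k 1) i)
        + c k * (D (EuclideanSpace.single j 1) i - D (EuclideanSpace.single i 1) j) = 0)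
    (a b d : Euc n) : ⟪c, a⟫ * (⟪D b, d⟫ - ⟪D d, b⟫) + ⟪c, b⟫ * (⟪D d, a⟫ - ⟪D a, d⟫)
      + ⟪c, d⟫ * (⟪D a, b⟫ - ⟪D b, a⟫) = 0 := by
  refine eq_zero_of_isLinearMap (f := fun a => ⟪c, a⟫ * (⟪D b, d⟫ - ⟪D d, b⟫) +
    ⟪c, b⟫ * (⟪D d, a⟫ - ⟪D a, d⟫) + ⟪c, d⟫ * (⟪D a, b⟫ - ⟪D b, a⟫)) ⟨?_, ?_⟩ (fun i => ?_) a
  · intro x y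
    simp only [inner_add_right, map_add, inner_add_left]; ring
  · intro r x
    simp only [inner_smul_right, map_smul, real_inner_smul_left, smul_eq_mul]; ring
  refine eq_zero_of_isLinearMap (f := fun b => ⟪c, EuclideanSpace.single i 1⟫ *
    (⟪D b, d⟫ - ⟪D d, b⟫) + ⟪c, b⟫ * (⟪D d, EuclideanSpace.single i 1⟫ -
      ⟪D (EuclideanSpace.single i 1), d⟫) + ⟪c, d⟫ * (⟪D (EuclideanSpace.single i 1), b⟫ -
      ⟪D b, EuclideanSpace.single i 1⟫)) ⟨?_, ?_⟩ (fun j => ?_) b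
  · intro x y
    simp only [inner_add_right, map_add, inner_add_left]; ring
  · intro r x
    simp only [inner_smul_right, map_smul, real_inner_smul_left, smul_eq_mul]; ring
  refine eq_zero_of_isLinearMap (f := fun d => ⟪c, EuclideanSpace.single i 1⟫ *
    (⟪D (EuclideanSpace.single j 1), d⟫ - ⟪D d, EuclideanSpace.single j 1⟫) +
      ⟪c, EuclideanSpace.single j 1⟫ * (⟪D d, EuclideanSpace.single i 1⟫ -
      ⟪D (EuclideanSpace.single i 1), d⟫) + ⟪c, d⟫ *
      (⟪D (EuclideanSpace.single i 1), EuclideanSpace.single j 1⟫ -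
      ⟪D (EuclideanSpace.single j 1), EuclideanSpace.single i 1⟫)) ⟨?_, ?_⟩ (fun k => ?_) d
  · intro x y
    simp only [inner_add_right, map_add, inner_add_left]; ring
  · intro r x
    simp only [inner_smul_right, map_smul, real_inner_smul_left, smul_eq_mul]; ring
  have := h i j k
  simp only [EuclideanSpace.inner_single_right, conj_trivial, one_mul]
  linarith

/-- A retraction onto a small cube centred at `x₀` does not increase distances. -/
theorem exists_clamp (x₀ : Euc n) {r : ℝ} (hr : 0 < r) :
    ∃ (c : Euc n → Euc n) (R : ℝ), 0 < R ∧ R ≤ r ∧ (∀ x y, ‖c x - c y‖ ≤ ‖x - y‖) ∧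
      (∀ x, ‖c x - x₀‖ ≤ r) ∧ ∀ x ∈ Metric.ball x₀ R, c x = x := by
  set ρ := r / (n + 1) with hρ
  have hρ0 : 0 < ρ := by positivity
  have hρr : (n + 1) * ρ = r := by rw [hρ]; field_simp
  let f : Fin n → ℝ → ℝ := fun i s => max (x₀ i - ρ) (min (x₀ i + ρ) s)
  have hf : ∀ i s t, |f i s - f i t| ≤ |s - t| := by
    intro i s t
    have h1 : LipschitzWith 1 (f i) := (LipschitzWith.id.const_min (x₀ i + ρ)).const_max (x₀ i - ρ)
    have := h1.dist_le_mul s t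
    simpa [Real.dist_eq] using this
  have hfr : ∀ i s, |f i s - x₀ i| ≤ ρ := by
    intro i s
    rw [abs_le]
    constructor
    · have := le_max_left (x₀ i - ρ) (min (x₀ i + ρ) s); simp only [f]; linarith
    · have : f i s ≤ x₀ i + ρ := max_le (by linarith) (min_le_left _ _)
      linarith
  refine ⟨fun x => WithLp.toLp 2 fun i => f i (x i), ρ, hρ0, ?_, fun x y => ?_, fun x => ?_,
    fun x hx => ?_⟩
  · rw [← hρr]
    nlinarith [(Nat.cast_nonneg n : (0 : ℝ) ≤ n)]
  · refine le_of_sq_le_sq ?_ (norm_nonneg _)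
    rw [EuclideanSpace.norm_sq_eq, EuclideanSpace.norm_sq_eq]
    refine Finset.sum_le_sum fun i _ => ?_
    have := hf i (x i) (y i)
    simp only [PiLp.sub_apply, Real.norm_eq_abs]
    gcongr
  · refine le_of_sq_le_sq ?_ hr.le
    rw [EuclideanSpace.norm_sq_eq]
    calc _ ≤ ∑ _i : Fin n, ρ ^ 2 := by
          refine Finset.sum_le_sum fun i _ => ?_
          have := hfr i (x i)
          simp only [PiLp.sub_apply, Real.norm_eq_abs]
          gcongr
      _ = n * ρ ^ 2 := by simp
      _ ≤ ((n + 1) * ρ) ^ 2 := by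
          have hn : (0 : ℝ) ≤ n := Nat.cast_nonneg n
          rw [mul_pow]
          gcongr
          nlinarith
      _ = r ^ 2 := by rw [hρr]
  · ext i
    have h1 : |x i - x₀ i| < ρ := by
      have := PiLp.norm_apply_le (x - x₀) i
      rw [Metric.mem_ball, dist_eq_norm] at hx
      simp only [PiLp.sub_apply, Real.norm_eq_abs] at this
      linarith
    rw [abs_lt] at h1
    simp only [f]
    rw [min_eq_right (by linarith), max_eq_right (by linarith)]

/-- Near a point `x₀` of `U` the field `g` is a positive multiple of a transversal field that is
flat almost everywhere. -/
theorem exists_flat_transversal (hU : IsOpen U) (hg0 : ∀ x ∈ U, g x ≠ 0)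
    (hgL : LocallyLipschitzOn U g) (hJ : JacobiCondition U g) (hx₀ : x₀ ∈ U) :
    ∃ (e : Euc n) (G : Euc n → Euc n) (K B R : ℝ), 0 < R ∧ Metric.ball x₀ R ⊆ U ∧
      IsTransversal G e K B ∧
      (∀ᵐ x ∂(volume.restrict (Metric.ball x₀ R)),
        ∀ a b, curvature e (G x) (fderiv ℝ G x) a b = 0) ∧
      ∀ x ∈ Metric.ball x₀ R, 0 < ⟪g x, e⟫ ∧ g x = ⟪g x, e⟫ • G x := by
  obtain ⟨L, s, hs, hL⟩ := hgL hx₀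
  rw [hU.nhdsWithin_eq hx₀] at hs
  obtain ⟨r₁, hr₁, hr₁s⟩ := Metric.mem_nhds_iff.1 (inter_mem hs (hU.mem_nhds hx₀))
  set m := ‖g x₀‖ with hm
  have hm0 : 0 < m := norm_pos_iff.2 (hg0 x₀ hx₀)
  set e := m⁻¹ • g x₀ with he
  have hen : ‖e‖ = 1 := by
    rw [he, norm_smul, norm_inv, Real.norm_of_nonneg hm0.le, ← hm, inv_mul_cancel₀ hm0.ne']
  -- within this radius `g` varies by at most `m / 2`, so that `⟪g, e⟫ ≥ m / 2`
  set r := min (r₁ / 2) (m / (2 * (L + 1))) with hr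
  have hr0 : 0 < r := by positivity
  have hrr₁ : r < r₁ := (min_le_left _ _).trans_lt (by linarith)
  have hLr : L * r ≤ m / 2 := by
    have h1 : r ≤ m / (2 * (L + 1)) := min_le_right _ _
    rw [le_div_iff₀ (by positivity)] at h1
    nlinarith
  have hmem : ∀ x, ‖x - x₀‖ ≤ r → x ∈ Metric.ball x₀ r₁ := fun x hx => by
    rw [Metric.mem_ball, dist_eq_norm]; exact hx.trans_lt hrr₁
  have hlip : ∀ x y, ‖x - x₀‖ ≤ r → ‖y - x₀‖ ≤ r → ‖g x - g y‖ ≤ L * ‖x - y‖ := by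
    intro x y hx hy
    have := hL.dist_le_mul x (hr₁s (hmem x hx)).1 y (hr₁s (hmem y hy)).1
    rwa [dist_eq_norm, dist_eq_norm] at this
  have hnear : ∀ x, ‖x - x₀‖ ≤ r → ‖g x - g x₀‖ ≤ m / 2 := fun x hx =>
    (hlip x x₀ hx (by simpa using hr0.le)).trans ((mul_le_mul_of_nonneg_left hx L.2).trans hLr)
  have hN : ∀ x, ‖x - x₀‖ ≤ r → m / 2 ≤ ⟪g x, e⟫ := by
    intro x hx
    have h1 : ⟪g x, e⟫ = m + ⟪g x - g x₀, e⟫ := by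
      have : ⟪g x₀, e⟫ = m := by
        rw [he, inner_smul_right, real_inner_self_eq_norm_sq, ← hm]; field_simp
      rw [inner_sub_left, this]; ring
    have h2 := abs_real_inner_le_norm (g x - g x₀) e
    rw [hen, mul_one] at h2
    have := (abs_le.1 (h2.trans (hnear x hx))).1
    linarith
  have hgn : ∀ x, ‖x - x₀‖ ≤ r → ‖g x‖ ≤ 2 * m := by
    intro x hx
    have h1 := norm_le_insert' (g x) (g x₀)
    have h2 := hnear x hx
    linarith
  obtain ⟨c, R, hR, hRr, hclip, hcr, hcid⟩ := exists_clamp x₀ hr0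
  let gn : Euc n → Euc n := fun x => ⟪g x, e⟫⁻¹ • g x
  have hRle : ∀ x ∈ Metric.ball x₀ R, ‖x - x₀‖ ≤ r := fun x hx => by
    rw [Metric.mem_ball, dist_eq_norm] at hx; linarith
  have hgnL : ∀ x y, ‖x - x₀‖ ≤ r → ‖y - x₀‖ ≤ r → ‖gn x - gn y‖ ≤ 10 * L / m * ‖x - y‖ := by
    intro x y hx hy
    have hNx := hN x hx
    have hNy := hN y hy
    have hd := hlip x y hx hy
    set a := ⟪g x, e⟫ with ha
    set b := ⟪g y, e⟫ with hb
    have ha0 : 0 < a := by linarith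
    have hb0 : 0 < b := by linarith
    have h1 : gn x - gn y = a⁻¹ • (g x - g y) + (a⁻¹ * b⁻¹ * (b - a)) • g y := by
      have h2 : a⁻¹ * b⁻¹ * (b - a) = a⁻¹ - b⁻¹ := by field_simp
      rw [h2]
      simp only [gn]
      module
    have hai : a⁻¹ ≤ 2 / m := by
      rw [inv_le_comm₀ ha0 (by positivity), inv_div]; exact hNx
    have hbi : b⁻¹ ≤ 2 / m := by
      rw [inv_le_comm₀ hb0 (by positivity), inv_div]; exact hNy
    have hab : |b - a| ≤ L * ‖x - y‖ := by
      rw [ha, hb, abs_sub_comm, ← inner_sub_left]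
      refine (abs_real_inner_le_norm _ _).trans ?_
      rwa [hen, mul_one]
    rw [h1]
    refine (norm_add_le _ _).trans ?_
    rw [norm_smul, norm_smul, norm_mul, norm_mul, norm_inv, norm_inv, Real.norm_of_nonneg ha0.le,
      Real.norm_of_nonneg hb0.le, Real.norm_eq_abs]
    have hgy := hgn y hy
    calc _ ≤ 2 / m * (L * ‖x - y‖) + 2 / m * (2 / m) * (L * ‖x - y‖) * (2 * m) := by gcongr
      _ = 10 * L / m * ‖x - y‖ := by field_simp; ring
  have hG : IsTransversal (gn ∘ c) e (10 * L / m) 4 := by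
    refine ⟨hen, fun x y => ?_, fun x => ?_, fun x => ?_, by positivity⟩
    · exact (hgnL _ _ (hcr x) (hcr y)).trans
        (mul_le_mul_of_nonneg_left (hclip x y) (by positivity))
    · have h1 := hN _ (hcr x)
      have h2 := hgn _ (hcr x)
      have h3 : 0 < ⟪g (c x), e⟫ := by linarith
      simp only [gn, Function.comp_apply]
      rw [norm_smul, norm_inv, Real.norm_of_nonneg h3.le, inv_mul_le_iff₀ h3]
      linarith
    · have h1 := hN _ (hcr x)
      have h3 : 0 < ⟪g (c x), e⟫ := by linarith
      simp only [gn, Function.comp_apply]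
      rw [real_inner_smul_left, inv_mul_cancel₀ h3.ne']
  have hRU : Metric.ball x₀ R ⊆ U := fun x hx => (hr₁s (hmem x (hRle x hx))).2
  refine ⟨e, gn ∘ c, 10 * L / m, 4, R, hR, hRU, hG, ?_, fun x hx => ?_⟩
  · have hrad := (hL.mono (hr₁s.trans inter_subset_left)).ae_differentiableWithinAt_of_mem
      (μ := volume)
    have hjac : ∀ᵐ x ∂(volume.restrict (Metric.ball x₀ R)), ∀ i j k : Fin n,
        g x i * (partialDeriv g j k x - partialDeriv g k j x)
          + g x j * (partialDeriv g k i x - partialDeriv g i k x)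
          + g x k * (partialDeriv g i j x - partialDeriv g j i x) = 0 := by
      refine ae_mono (Measure.restrict_mono hRU le_rfl) ?_
      exact ae_all_iff.2 fun i => ae_all_iff.2 fun j => ae_all_iff.2 fun k => hJ i j k
    filter_upwards [ae_restrict_mem measurableSet_ball, ae_restrict_of_ae hrad, hjac]
      with x hx hxd hxJ a b
    have hxr := hRle x hx
    have hgd : HasFDerivAt g (fderiv ℝ g x) x :=
      ((hxd (hmem x hxr)).differentiableAt (Metric.isOpen_ball.mem_nhds (hmem x hxr))).hasFDerivAt
    have hNx : ⟪g x, e⟫ ≠ 0 := by have := hN x hxr; linarith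
    have hGgn : gn ∘ c =ᶠ[𝓝 x] gn := by
      filter_upwards [Metric.isOpen_ball.mem_nhds hx] with y hy
      rw [Function.comp_apply, hcid y hy]
    rw [hGgn.fderiv_eq, hGgn.self_of_nhds]
    refine curvature_normalize_eq_zero (D := fderiv ℝ g x) hNx (fun v => ?_)
      (trilinear_of_jacobi fun i j k => hxJ i j k) a b
    have hNd : HasFDerivAt (fun y => ⟪g y, e⟫) ((innerSL ℝ e).comp (fderiv ℝ g x)) x := by
      have h1 := (innerSL ℝ e).hasFDerivAt.comp x hgd
      refine h1.congr_of_eventuallyEq (Eventually.of_forall fun y => ?_)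
      simp [real_inner_comm]
    have h2 := ((hasDerivAt_inv hNx).comp_hasFDerivAt x hNd).smul hgd
    have h3 : fderiv ℝ gn x = _ := h2.fderiv
    rw [h3]
    simp only [_root_.add_apply, _root_.smul_apply, ContinuousLinearMap.smulRight_apply,
      ContinuousLinearMap.comp_apply, innerSL_apply_apply, smul_eq_mul, Function.comp_apply,
      real_inner_comm e]
    module
  · have h1 := hN x (hRle x hx)
    have h3 : 0 < ⟪g x, e⟫ := by linarith
    refine ⟨h3, ?_⟩
    simp only [gn, Function.comp_apply, hcid x hx]
    rw [smul_smul, mul_inv_cancel₀ h3.ne', one_smul]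

/-- Frobenius' theorem for locally Lipschitz fields: every point has a ball on which a
regular solution exists. -/
theorem exists_isRegularSolution (hU : IsOpen U) (hg0 : ∀ x ∈ U, g x ≠ 0)
    (hgL : LocallyLipschitzOn U g) (hJ : JacobiCondition U g) (hx₀ : x₀ ∈ U) :
    ∃ (δ : ℝ) (u : Euc n → ℝ), 0 < δ ∧ IsRegularSolution U g (Metric.ball x₀ δ) u := by
  have hn : n ≠ 0 := by
    rintro rfl
    exact hg0 x₀ hx₀ (Subsingleton.elim _ _)
  obtain ⟨e, G, K, B, R, hR, hRU, hG, hflat, hgG⟩ := exists_flat_transversal hU hg0 hgL hJ hx₀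
  have hB := hG.B_nonneg
  have hd : 0 < 1 + 2 * B := by positivity
  set δ := min 1 (R / 4) / (1 + 2 * B) with hδ
  have hδe : (1 + 2 * B) * δ = min 1 (R / 4) := by rw [hδ]; field_simp
  refine ⟨δ, leafHeight G e x₀, by positivity, ?_⟩
  refine isRegularSolution_leafHeight hn hG hflat hgG hgL.continuousOn hg0 hRU (by positivity) ?_ ?_
  · rw [hδe]; exact min_le_left _ _
  · rw [hδe]; exact (min_le_right _ _).trans_lt (by linarith)

theorem strictLocalCondition_of_strictQuasiConvex (hU : IsOpen U) (hg0 : ∀ x ∈ U, g x ≠ 0)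
    (hgL : LocallyLipschitzOn U g) (hJ : JacobiCondition U g)
    (hIII : RegularSolutionsStrictlyQuasiConvex U g) : StrictLocalCondition U g := by
  intro x₀ hx₀
  obtain ⟨δ, u, hδ, hu⟩ := exists_isRegularSolution hU hg0 hgL hJ hx₀
  have hV : Convex ℝ (Metric.ball x₀ δ) := convex_ball _ _
  exact ⟨Metric.ball x₀ δ, Metric.isOpen_ball, hu.normal.subset, Metric.mem_ball_self hδ,
    fun x hx y hy hxy h => inner_lt_of_strictQuasiConvexOn hg0 hV hu (hIII _ u hV hu) hx hy hxy h⟩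

end TDE

end

theorem mainTheorem4 (n : ℕ) (U : Set (TDE.Euc n)) (g : TDE.Euc n → TDE.Euc n)
    (hU : IsOpen U) (hg0 : ∀ x ∈ U, g x ≠ 0) (hgL : LocallyLipschitzOn U g)
    (hJ : TDE.JacobiCondition U g) :
    (TDE.StrictLocalCondition U g ↔ TDE.RegularSolutionsStrictlyQuasiConvex U g) ∧
    (TDE.StrictLimsupCondition U g →
      TDE.StrictLocalCondition U g ∧ TDE.RegularSolutionsStrictlyQuasiConvex U g) := by
  have hback := TDE.strictLocalCondition_of_strictQuasiConvex hU hg0 hgL hJ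
  refine ⟨⟨TDE.strictQuasiConvex_of_strictLocalCondition hg0, hback⟩, fun hII => ?_⟩
  have hIII := TDE.strictQuasiConvex_of_strictLimsupCondition hU hg0 hgL hII
  exact ⟨hback hIII, hIII⟩
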